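/- Let $s\ge 2$ and let $X$ be a smooth manifold with a Riemannian metric $\mathbf g$ and a (pointwise, nondegenerate) $s$-Kähler structure of rank two: smooth two-forms $\omega_{jk}$, $j,k\in\{0,\dots,s\}$, such that every point $p\in X$ has an adapted coframe, i.e. an orthonormal basis $(v_{ij})_{i\in\{1,2\},\,0\le j\le s}$ of $T_p^*X$ with $\omega_{jk}=v_{1j}\wedge v_{1k}+v_{2j}\wedge v_{2k}$ at $p$ for all $j,k$. (In particular this covers almost $s$-Kähler and $s$-Kähler manifolds of rank two and dimension $2(s+1)$.) Fix $p\in X$ and an adapted coframe $v=(v_{ij})$ at $p$. On $\bigwedge^*T_p^*X$ let $L_{jk}$ ($j\ne k$) be the wedge product with $\omega_{jk}$, let $V_j$ be the wedge product with $v_{1j}\wedge v_{2j}$, and let $\Lambda_{jk}=L_{jk}^*$, $A_j=V_j^*$ be the adjoints with respect to the inner product induced by $\mathbf g$. Let $\mathcal L^s_{\mathbb R,p}$ be the real Lie algebra of operators on $\bigwedge^*T_p^*X$ generated by all $L_{jk},V_j,\Lambda_{jk},A_j$, and let $\mathcal L^s_{\mathbb C,p}=\mathcal L^s_{\mathbb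 R,p}\otimes_{\mathbb R}\mathbb C$, which acts on $\bigwedge^*_{\mathbb C}T_p^*X=\bigwedge^*T_p^*X\otimes_{\mathbb R}\mathbb C$. Let $(\cdot,\cdot)$ be the Hermitian inner product on $\bigwedge^*_{\mathbb C}T_p^*X$ induced by $\mathbf g$, let $\Omega=v_{10}\wedge v_{20}\wedge v_{11}\wedge v_{21}\wedge\dots\wedge v_{1s}\wedge v_{2s}$, and define, for homogeneous $\alpha,\beta$ (and by additive extension in general), $$\langle\alpha,\beta\rangle=i^{\deg\alpha\,\deg\beta}\,(\alpha\wedge\overline\beta,\Omega),\qquad \langle\langle\alpha,\beta\rangle\rangle=i^{\,s+1+\deg\beta}\,\langle\alpha,\beta\rangle .$$ Theorem. For every $p\in X$ and every adapted coframe $v$ at $p$: 1. $\mathcal L^s_{\mathbb R,p}$ does not depend on the choice of the adapted coframe $v$ at $p$; thus the fibres $\mathcal L^s_{\mathbb R,p}$ and $\mathcal L^s_{\mathbb C,p}$ of the bundles $\mathcal L^s_{\mathbb R}$ and $\mathcal L^s_{\mathbb C}$ are well defined. 2. $\mathcal L^s_{\mathbb R,p}$ (acting on $\bigwedge^*_{\mathbb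 C}T_p^*X$ by complex linear extension) is exactly the set of all $\varphi\in\mathcal L^s_{\mathbb C,p}$ that preserve $\langle\langle\cdot,\cdot\rangle\rangle$, i.e. that satisfy $\langle\langle\varphi\alpha,\beta\rangle\rangle+\langle\langle\alpha,\varphi\beta\rangle\rangle=0$ for all $\alpha,\beta\in\bigwedge^*_{\mathbb C}T_p^*X$. 3. $\mathcal L^s_{\mathbb R,p}$ is isomorphic, as a real Lie algebra, to $\mathbf{su}(s+1,s+1)$. -/

import Mathlib

open Bundle
open scoped Manifold ContDiff TensorProduct

attribute [local instance] LieRing.ofAssociativeRing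

noncomputable section

namespace SKahler

/-! ### Euclidean linear algebra of the exterior algebra -/

/-- The inner product on covectors induced by the inner product on vectors through the musical
isomorphism (its norm is the operator norm). -/
instance instInnerProductSpaceDual (T : Type*) [NormedAddCommGroup T] [InnerProductSpace ℝ T]
    [CompleteSpace T] : InnerProductSpace ℝ (StrongDual ℝ T) where
  inner x y :=
    inner ℝ ((InnerProductSpace.toDual ℝ T).symm x) ((InnerProductSpace.toDual ℝ T).symm y)
  norm_sq_eq_re_inner x := by
    rw [real_inner_self_eq_norm_sq, LinearIsometryEquiv.norm_map]; rfl
  conj_inner_symm x y := real_inner_comm _ _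
  add_left x y z := by simp [inner_add_left]
  smul_left x y r := by simp [inner_smul_left]

section Linear

variable (V : Type*) [NormedAddCommGroup V] [InnerProductSpace ℝ V] [FiniteDimensional ℝ V]

/-- The real exterior algebra `⋀* V`; its product is the wedge product. -/
abbrev Ext : Type _ := ExteriorAlgebra ℝ V

/-- The complexified exterior algebra `⋀*_ℂ V = ℂ ⊗ ⋀* V`; its product is the wedge product. -/
abbrev ExtC : Type _ := ℂ ⊗[ℝ] ExteriorAlgebra ℝ V

/-- The homogeneous component of degree `k` of a form. -/
def component (k : ℕ) : Ext V →ₗ[ℝ] ⋀[ℝ]^k V :=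
  DirectSum.component ℝ ℕ (fun n => ⋀[ℝ]^n V) k ∘ₗ
    (DirectSum.decomposeLinearEquiv (fun n => ⋀[ℝ]^n V)).toLinearMap

/-- The inner product induced on `⋀* V`: different degrees are orthogonal, and in each
degree it is the Gram determinant inner product. -/
def metric : LinearMap.BilinForm ℝ (Ext V) :=
  ∑ k ∈ Finset.range (Module.finrank ℝ V + 1),
    (innerₗ (⋀[ℝ]^k V)).compl₁₂ (component V k) (component V k)

theorem metric_apply (x y : Ext V) : metric V x y =
    ∑ k ∈ Finset.range (Module.finrank ℝ V + 1), inner ℝ (component V k x) (component V k y) := by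
  simp [metric, LinearMap.sum_apply]

theorem component_eq_zero_of_lt {k : ℕ} (hk : Module.finrank ℝ V < k) (x : Ext V) :
    component V k x = 0 := by
  have h : Module.finrank ℝ (⋀[ℝ]^k V) = 0 := by
    rw [exteriorPower.finrank_eq, Nat.choose_eq_zero_of_lt hk]
  exact (Module.finrank_zero_iff.mp h).elim _ _

theorem metric_self_eq_zero {x : Ext V} (h : metric V x x = 0) : x = 0 := by
  rw [metric_apply, Finset.sum_eq_zero_iff_of_nonneg (fun _ _ => real_inner_self_nonneg)] at h
  apply (DirectSum.decomposeLinearEquiv (fun n => ⋀[ℝ]^n V)).injective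
  rw [map_zero]
  refine DFinsupp.ext fun k => ?_
  change component V k x = 0
  by_cases hk : k < Module.finrank ℝ V + 1
  · exact inner_self_eq_zero.mp (h k (Finset.mem_range.mpr hk))
  · exact component_eq_zero_of_lt V (by omega) x

theorem metric_nondegenerate : (metric V).Nondegenerate :=
  ⟨fun x h => metric_self_eq_zero V (h x), fun x h => metric_self_eq_zero V (h x)⟩

instance instFiniteExt : FiniteDimensional ℝ (Ext V) :=
  Module.Finite.of_basis (Module.finBasis ℝ V).ExteriorAlgebra

variable {V}

/-- The metric adjoint `φ*` of an operator on `⋀* V`. -/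
def adj (φ : Module.End ℝ (Ext V)) : Module.End ℝ (Ext V) :=
  (metric V).leftAdjointOfNondegenerate (metric_nondegenerate V) φ

theorem metric_adj (φ : Module.End ℝ (Ext V)) (x y : Ext V) :
    metric V (adj φ x) y = metric V x (φ y) :=
  (metric V).isAdjointPairLeftAdjointOfNondegenerate (metric_nondegenerate V) φ x y

/-! ### The operators and the Lie algebras they generate

Here `w j k` (that is, `ω_{jk}`) are two-forms in `⋀* V` and `v (i, j)`, for `i ∈ {0, 1}` and
`j ∈ {0, …, s}`, is an orthonormal coframe (the index `i` is shifted by one from the usual `v_{1j}`, `v_{2j}`). -/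

variable {s : ℕ}

/-- `L_{jk}`, the wedge product with `ω_{jk}`. -/
def opL (w : Fin (s + 1) → Fin (s + 1) → Ext V) (j k : Fin (s + 1)) : Module.End ℝ (Ext V) :=
  LinearMap.mulLeft ℝ (w j k)

/-- `Λ_{jk} = L_{jk}*`. -/
def opLambda (w : Fin (s + 1) → Fin (s + 1) → Ext V) (j k : Fin (s + 1)) :
    Module.End ℝ (Ext V) :=
  adj (opL w j k)

/-- `V_j`, the wedge product with the volume form `v_{1j} ∧ v_{2j}` of `W_j`. -/
def opV (v : OrthonormalBasis (Fin 2 × Fin (s + 1)) ℝ V) (j : Fin (s + 1)) :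
    Module.End ℝ (Ext V) :=
  LinearMap.mulLeft ℝ (ExteriorAlgebra.ι ℝ (v (0, j)) * ExteriorAlgebra.ι ℝ (v (1, j)))

/-- `A_j = V_j*`. -/
def opA (v : OrthonormalBasis (Fin 2 × Fin (s + 1)) ℝ V) (j : Fin (s + 1)) :
    Module.End ℝ (Ext V) :=
  adj (opV v j)

/-- The set of generators `L_{jk}`, `Λ_{jk}` (`j ≠ k`), `V_j`, `A_j`. -/
def generators (w : Fin (s + 1) → Fin (s + 1) → Ext V)
    (v : OrthonormalBasis (Fin 2 × Fin (s + 1)) ℝ V) : Set (Module.End ℝ (Ext V)) :=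
  {φ | (∃ j k, j ≠ k ∧ (φ = opL w j k ∨ φ = opLambda w j k)) ∨ ∃ j, φ = opV v j ∨ φ = opA v j}

/-- The real Lie algebra of operators on `⋀* V` generated by `L_{jk}`, `V_j`, `Λ_{jk}`, `A_j`. -/
def realAlgebra (w : Fin (s + 1) → Fin (s + 1) → Ext V)
    (v : OrthonormalBasis (Fin 2 × Fin (s + 1)) ℝ V) :
    LieSubalgebra ℝ (Module.End ℝ (Ext V)) :=
  LieSubalgebra.lieSpan ℝ (Module.End ℝ (Ext V)) (generators w v)

/-- The complexification of a real Lie algebra `𝔤` of operators on `⋀* V`: the image of `ℂ ⊗ 𝔤` in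
the operators on `⋀*_ℂ V`, that is, the complex span of the complexifications of the elements
of `𝔤`. -/
def complexification (𝔤 : LieSubalgebra ℝ (Module.End ℝ (Ext V))) :
    LieSubalgebra ℂ (Module.End ℂ (ExtC V)) where
  toSubmodule := Submodule.span ℂ {φ | ∃ ψ ∈ 𝔤, φ = LinearMap.baseChange ℂ ψ}
  lie_mem' := by
    intro x y hx hy
    simp only [AddSubsemigroup.mem_carrier, AddSubmonoid.mem_toSubsemigroup,
      Submodule.mem_toAddSubmonoid] at hx hy ⊢
    induction hx using Submodule.span_induction with
    | zero => simp
    | add a b _ _ ha hb => rw [add_lie]; exact add_mem ha hb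
    | smul c a _ ha => rw [smul_lie]; exact Submodule.smul_mem _ _ ha
    | mem a ha =>
      obtain ⟨ψ, hψ, rfl⟩ := ha
      induction hy using Submodule.span_induction with
      | zero => simp
      | add a b _ _ ha hb => rw [lie_add]; exact add_mem ha hb
      | smul c a _ ha => rw [lie_smul]; exact Submodule.smul_mem _ _ ha
      | mem b hb =>
        obtain ⟨χ, hχ, rfl⟩ := hb
        refine Submodule.subset_span ⟨⁅ψ, χ⁆, 𝔤.lie_mem hψ hχ, ?_⟩
        simp only [Ring.lie_def, LinearMap.baseChange_sub, Module.End.mul_eq_comp,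
          LinearMap.baseChange_comp]

/-! ### The Hermitian forms -/

/-- Complex conjugation on `⋀*_ℂ V`. -/
def conj : ExtC V →ₗ[ℝ] ExtC V :=
  TensorProduct.map Complex.conjAe.toLinearMap LinearMap.id

/-- The standard Hermitian inner product `(α, β)` on `⋀*_ℂ V`, linear in `α` and conjugate linear
in `β`. -/
def herm (α β : ExtC V) : ℂ :=
  (metric V).baseChange ℂ α (conj β)

/-- The homogeneous component of degree `k` of a complex form, as a form. -/
def componentC (k : ℕ) : ExtC V →ₗ[ℂ] ExtC V :=
  LinearMap.baseChange ℂ ((⋀[ℝ]^k V).subtype ∘ₗ component V k)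

/-- The volume form `Ω = v_{10} ∧ v_{20} ∧ v_{11} ∧ v_{21} ∧ ⋯ ∧ v_{1s} ∧ v_{2s}`. -/
def volumeForm (v : OrthonormalBasis (Fin 2 × Fin (s + 1)) ℝ V) : ExtC V :=
  1 ⊗ₜ (List.ofFn fun j : Fin (s + 1) =>
    ExteriorAlgebra.ι ℝ (v (0, j)) * ExteriorAlgebra.ι ℝ (v (1, j))).prod

/-- The form `<α, β>`, which is `i ^ (deg α * deg β) * (α ∧ conj β, Ω)` for homogeneous `α`, `β`
and is extended additively. -/
def form (v : OrthonormalBasis (Fin 2 × Fin (s + 1)) ℝ V) (α β : ExtC V) : ℂ :=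
  ∑ a ∈ Finset.range (Module.finrank ℝ V + 1), ∑ b ∈ Finset.range (Module.finrank ℝ V + 1),
    Complex.I ^ (a * b) * herm (componentC a α * conj (componentC b β)) (volumeForm v)

/-- The modified form `<<α, β>>`, which is `i ^ (s + 1 + deg β) * <α, β>` for homogeneous `α`, `β`
and is extended additively. -/
def modifiedForm (v : OrthonormalBasis (Fin 2 × Fin (s + 1)) ℝ V) (α β : ExtC V) : ℂ :=
  ∑ b ∈ Finset.range (Module.finrank ℝ V + 1),
    Complex.I ^ (s + 1 + b) * form v α (componentC b β)

/-- The operator `φ` preserves the modified form, infinitesimally. -/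
def PreservesModifiedForm (v : OrthonormalBasis (Fin 2 × Fin (s + 1)) ℝ V)
    (φ : Module.End ℂ (ExtC V)) : Prop :=
  ∀ α β : ExtC V, modifiedForm v (φ α) β + modifiedForm v α (φ β) = 0

end Linear

/-! ### The real Lie algebra `su(p, q)` -/

/-- The diagonal matrix with `p` entries `1` and `q` entries `-1`. -/
def signatureMatrix (p q : ℕ) : Matrix (Fin p ⊕ Fin q) (Fin p ⊕ Fin q) ℂ :=
  Matrix.diagonal (Sum.elim (fun _ => 1) (fun _ => -1))

/-- The real Lie algebra `su(p, q)` of the traceless complex matrices that are anti-Hermitian for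
the standard Hermitian form of signature `(p, q)`. -/
def su (p q : ℕ) : LieSubalgebra ℝ (Matrix (Fin p ⊕ Fin q) (Fin p ⊕ Fin q) ℂ) where
  carrier := {X | X.trace = 0 ∧
    X.conjTranspose * signatureMatrix p q + signatureMatrix p q * X = 0}
  add_mem' := by
    rintro X Y ⟨hX, hX'⟩ ⟨hY, hY'⟩
    refine ⟨by rw [Matrix.trace_add, hX, hY, add_zero], ?_⟩
    rw [Matrix.conjTranspose_add, add_mul, mul_add, add_add_add_comm, hX', hY', add_zero]
  zero_mem' := by simp
  smul_mem' := by
    rintro c X ⟨hX, hX'⟩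
    refine ⟨by rw [Matrix.trace_smul, hX, smul_zero], ?_⟩
    rw [Matrix.conjTranspose_smul, star_trivial, Matrix.smul_mul, Matrix.mul_smul, ← smul_add,
      hX', smul_zero]
  lie_mem' := by
    rintro X Y ⟨hX, hX'⟩ ⟨hY, hY'⟩
    refine ⟨by rw [Ring.lie_def, Matrix.trace_sub, Matrix.trace_mul_comm, sub_self], ?_⟩
    have h1 := eq_neg_of_add_eq_zero_left hX'
    have h2 := eq_neg_of_add_eq_zero_left hY'
    rw [Ring.lie_def, Matrix.conjTranspose_sub, Matrix.conjTranspose_mul,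
      Matrix.conjTranspose_mul, sub_mul, Matrix.mul_assoc, Matrix.mul_assoc, h1, h2, mul_neg,
      mul_neg, ← Matrix.mul_assoc, ← Matrix.mul_assoc, h1, h2]
    noncomm_ring

/-! ### Almost `s`-Kähler manifolds of rank two -/

section Manifold

variable {E : Type*} [NormedAddCommGroup E] [NormedSpace ℝ E] [FiniteDimensional ℝ E]
  {M : Type*} [TopologicalSpace M] [ChartedSpace E M]

instance instFiniteDimensionalTangent (p : M) :
    FiniteDimensional ℝ (TangentSpace 𝓘(ℝ, E) p) :=
  inferInstanceAs (FiniteDimensional ℝ E)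

variable [IsManifold 𝓘(ℝ, E) ∞ M] [RiemannianBundle (fun p : M => TangentSpace 𝓘(ℝ, E) p)]

instance instCompleteSpaceTangent (p : M) : CompleteSpace (TangentSpace 𝓘(ℝ, E) p) :=
  FiniteDimensional.complete ℝ (TangentSpace 𝓘(ℝ, E) p)

/-- The cotangent space at `p`, with the Euclidean structure induced by the Riemannian metric. -/
abbrev Cotangent (E : Type*) [NormedAddCommGroup E] [NormedSpace ℝ E] {M : Type*}
    [TopologicalSpace M] [ChartedSpace E M]
    [RiemannianBundle (fun p : M => TangentSpace 𝓘(ℝ, E) p)] (p : M) : Type _ :=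
  StrongDual ℝ (TangentSpace 𝓘(ℝ, E) p)

/-- The element `½ ∑_{a, b} η(e_a, e_b) e^a ∧ e^b` of `⋀* T*_p M` that corresponds to the
alternating two-form `η`; here `e_a` is an orthonormal basis and `e^a` its dual basis. -/
def toExt {p : M} (η : TangentSpace 𝓘(ℝ, E) p [⋀^Fin 2]→L[ℝ] ℝ) : Ext (Cotangent E p) :=
  let e := stdOrthonormalBasis ℝ (TangentSpace 𝓘(ℝ, E) p)
  (1 / 2 : ℝ) • ∑ a, ∑ b, η ![e a, e b] •
    (ExteriorAlgebra.ι ℝ (InnerProductSpace.toDual ℝ _ (e a)) *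
      ExteriorAlgebra.ι ℝ (InnerProductSpace.toDual ℝ _ (e b)))

/-- The orthonormal coframe `v` at `p` is adapted to the two-forms `ω_{jk}`:
`ω_{jk} = v_{1j} ∧ v_{1k} + v_{2j} ∧ v_{2k}` at `p`, for all `j` and `k`. -/
def IsAdapted {s : ℕ} {p : M}
    (w : Fin (s + 1) → Fin (s + 1) → TangentSpace 𝓘(ℝ, E) p [⋀^Fin 2]→L[ℝ] ℝ)
    (v : OrthonormalBasis (Fin 2 × Fin (s + 1)) ℝ (Cotangent E p)) : Prop :=
  ∀ (j k : Fin (s + 1)) (x y : TangentSpace 𝓘(ℝ, E) p),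
    w j k ![x, y] = ∑ i : Fin 2, (v (i, j) x * v (i, k) y - v (i, j) y * v (i, k) x)

variable (E M) in
/-- A (pointwise, nondegenerate) `s`-Kähler structure of rank two on the Riemannian manifold `M`:
smooth two-forms `ω_{jk}` for which there is an adapted orthonormal coframe at every point.
(An almost `s`-Kähler structure is one whose forms `ω_{0k}` moreover have a local Darboux form;
an `s`-Kähler structure is one whose forms are moreover parallel.) -/
structure Structure (s : ℕ) where
  /-- The two-forms `ω_{jk}`. -/
  w : Fin (s + 1) → Fin (s + 1) → (p : M) → TangentSpace 𝓘(ℝ, E) p [⋀^Fin 2]→L[ℝ] ℝ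
  smooth : ∀ j k, ContMDiff 𝓘(ℝ, E) (𝓘(ℝ, E).prod 𝓘(ℝ, E [⋀^Fin 2]→L[ℝ] ℝ)) ∞
    (fun p => (⟨p, w j k p⟩ : TotalSpace (E [⋀^Fin 2]→L[ℝ] ℝ)
      (fun q : M => TangentSpace 𝓘(ℝ, E) q [⋀^Fin 2]→L[ℝ] Bundle.Trivial M ℝ q)))
  exists_adapted : ∀ p, ∃ v : OrthonormalBasis (Fin 2 × Fin (s + 1)) ℝ (Cotangent E p),
    IsAdapted (fun j k => w j k p) v

namespace Structure

variable {s : ℕ} (S : Structure E M s)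

/-- The adapted orthonormal coframes at `p`. The choice of one of them fixes an orientation
of `W_0`, that is, a determination of `J` at `p`. -/
abbrev Coframe (p : M) : Type _ :=
  {v : OrthonormalBasis (Fin 2 × Fin (s + 1)) ℝ (Cotangent E p) //
    IsAdapted (fun j k => S.w j k p) v}

/-- The fibre of the real bundle `L^s_ℝ` at `p`, for the determination of `J` given by `v`. -/
def realFibre {p : M} (v : S.Coframe p) :
    LieSubalgebra ℝ (Module.End ℝ (Ext (Cotangent E p))) :=
  realAlgebra (fun j k => toExt (S.w j k p)) v.1

/-- The fibre of the complex bundle `L^s_ℂ = L^s_ℝ ⊗ ℂ` at `p`. -/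
def complexFibre {p : M} (v : S.Coframe p) :
    LieSubalgebra ℂ (Module.End ℂ (ExtC (Cotangent E p))) :=
  complexification (S.realFibre v)

end Structure

end Manifold

end SKahler

end

/-! Wedge products and contractions with an orthonormal coframe satisfy the canonical
anticommutation relations, and every generator is quadratic in them. After complexification, each
pair `v (0, j)`, `v (1, j)` is replaced by charge eigenstates, and in half of the resulting modes
creation and annihilation exchange roles. Quadratic expressions that did not conserve particle
number then become sums `∑ X a b • (c a * d b)`, the second quantization of a matrix `X` of size 2(s
+ 1). Second quantization is an injective Lie homomorphism (`IsCAR.secondQuant_lie`,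
`IsCAR.secondQuant_injective`), so the third claim is about matrices. The generators come from the
off-diagonal blocks ±(E_jk - E_kj) and ±i E_jj, which generate over ℝ all traceless matrices
anti-Hermitian for the swap form (`lieSpan_splitGenerators`). That form has signature (s + 1, s +
1), and a Cayley matrix carries the algebra to su(s + 1, s + 1).

For the second claim, the powers of i in the modified form are such that wedging with, or
contracting by, two covectors is skew for it (`realAlgebra_le_preserving`). An element ψ + iχ of the
complexification preserves this sesquilinear form only if χ is both skew and symmetric for it;
Poincaré duality makes the form nondegenerate, so χ = 0.

For the first claim, evaluating ω_jk in two adapted coframes shows that both span the same planes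
W_j (`inner_eq_zero_of_isAdapted`). Hence V_j and A_j are determined up to sign, while L_jk and Λ_jk
involve no coframe. The bound s ≥ 2 enters through the existence of a third index: once in
generating the matrix algebra, once in comparing coframes. -/

set_option linter.unusedSectionVars false

noncomputable section

namespace SKahler

/-! ### Wedge products and contractions as adjoint operators -/

section ExteriorCalculus

variable {V : Type*} [NormedAddCommGroup V] [InnerProductSpace ℝ V] [FiniteDimensional ℝ V]

/-- The wedge product with the vector `u`. -/
def wedge (u : V) : Module.End ℝ (Ext V) := LinearMap.mulLeft ℝ (ExteriorAlgebra.ι ℝ u)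

/-- The contraction with the vector `u`. -/
def ctr (u : V) : Module.End ℝ (Ext V) := CliffordAlgebra.contractLeft (innerₗ V u)

@[simp]
theorem wedge_apply (u : V) (x : Ext V) : wedge u x = ExteriorAlgebra.ι ℝ u * x := rfl

theorem ctr_ι_mul (u a : V) (x : Ext V) :
    ctr u (ExteriorAlgebra.ι ℝ a * x) = inner ℝ u a • x - ExteriorAlgebra.ι ℝ a * ctr u x :=
  CliffordAlgebra.contractLeft_ι_mul _ _ _

theorem ctr_one (u : V) : ctr u (1 : Ext V) = 0 :=
  CliffordAlgebra.contractLeft_one _ (innerₗ V u)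

theorem ctr_ιMulti_zero (u : V) (b : Fin 0 → V) : ctr u (ExteriorAlgebra.ιMulti ℝ 0 b) = 0 := by
  rw [ExteriorAlgebra.ιMulti_zero_apply, ctr_one]

theorem ctr_ιMulti (u : V) {n : ℕ} (b : Fin (n + 1) → V) :
    ctr u (ExteriorAlgebra.ιMulti ℝ (n + 1) b) = ∑ i : Fin (n + 1),
      ((-1 : ℝ) ^ (i : ℕ) * inner ℝ u (b i)) • ExteriorAlgebra.ιMulti ℝ n (b ∘ i.succAbove) := by
  induction n with
  | zero =>
    rw [ExteriorAlgebra.ιMulti_succ_apply, ctr_ι_mul, ExteriorAlgebra.ιMulti_zero_apply, ctr_one]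
    simp
  | succ n ih =>
    rw [ExteriorAlgebra.ιMulti_succ_apply, ctr_ι_mul, ih, Fin.sum_univ_succ (n := n + 1)]
    simp only [Fin.val_zero, pow_zero, one_mul, Fin.val_succ]
    rw [sub_eq_add_neg, Finset.mul_sum, ← Finset.sum_neg_distrib]
    congr 1
    refine Finset.sum_congr rfl fun i _ => ?_
    rw [ExteriorAlgebra.ιMulti_succ_apply, mul_smul_comm, ← neg_smul, pow_succ]
    simp only [Matrix.vecTail, Function.comp_apply, Fin.succ_succAbove_zero]
    congr 1
    · simp
    · congr 2
      funext j
      simp [Function.comp]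

theorem component_of_mem {k : ℕ} {x : Ext V} (hx : x ∈ ⋀[ℝ]^k V) : component V k x = ⟨x, hx⟩ := by
  apply Subtype.ext
  exact DirectSum.decompose_of_mem_same (fun n => ⋀[ℝ]^n V) hx

theorem component_of_mem_ne {k l : ℕ} {x : Ext V} (hx : x ∈ ⋀[ℝ]^k V) (h : k ≠ l) :
    component V l x = 0 := by
  apply Subtype.ext
  exact DirectSum.decompose_of_mem_ne (fun n => ⋀[ℝ]^n V) hx h

theorem metric_of_mem {k : ℕ} {x : Ext V} (hx : x ∈ ⋀[ℝ]^k V) (y : Ext V) :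
    metric V x y = inner ℝ (component V k x) (component V k y) := by
  rw [metric_apply]
  by_cases hk : k ∈ Finset.range (Module.finrank ℝ V + 1)
  · refine Finset.sum_eq_single_of_mem k hk fun l _ hl => ?_
    rw [component_of_mem_ne hx hl.symm, inner_zero_left]
  · rw [Finset.sum_eq_zero fun l hl => ?_, component_eq_zero_of_lt V (by simpa using hk) x,
      inner_zero_left]
    rw [component_of_mem_ne hx (by rintro rfl; exact hk hl), inner_zero_left]

theorem metric_eq_zero_of_mem {k l : ℕ} {x y : Ext V} (hx : x ∈ ⋀[ℝ]^k V) (hy : y ∈ ⋀[ℝ]^l V)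
    (h : k ≠ l) : metric V x y = 0 := by
  rw [metric_of_mem hx, component_of_mem_ne hy h.symm, inner_zero_right]

theorem ιMulti_mem (n : ℕ) (a : Fin n → V) : ExteriorAlgebra.ιMulti ℝ n a ∈ ⋀[ℝ]^n V :=
  ExteriorAlgebra.ιMulti_range ℝ n ⟨a, rfl⟩

theorem metric_ιMulti (n : ℕ) (a b : Fin n → V) :
    metric V (ExteriorAlgebra.ιMulti ℝ n a) (ExteriorAlgebra.ιMulti ℝ n b) =
      Matrix.det (Matrix.of fun i j => inner ℝ (a j) (b i)) := by
  rw [metric_of_mem (ιMulti_mem n a), component_of_mem (ιMulti_mem n a),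
    component_of_mem (ιMulti_mem n b)]
  exact exteriorPower.inner_ιMulti_ιMulti a b

theorem metric_comm (x y : Ext V) : metric V x y = metric V y x := by
  simp only [metric_apply]
  exact Finset.sum_congr rfl fun _ _ => real_inner_comm _ _

theorem ctr_mem (u : V) {n : ℕ} {x : Ext V} (hx : x ∈ ⋀[ℝ]^(n + 1) V) : ctr u x ∈ ⋀[ℝ]^n V := by
  rw [← ExteriorAlgebra.ιMulti_span_fixedDegree] at hx
  induction hx using Submodule.span_induction with
  | zero => rw [map_zero]; exact zero_mem _
  | add _ _ _ _ h h' => rw [map_add]; exact add_mem h h'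
  | smul c _ _ h => rw [map_smul]; exact Submodule.smul_mem _ _ h
  | mem x hx =>
    obtain ⟨b, rfl⟩ := hx
    rw [ctr_ιMulti]
    exact Submodule.sum_mem _ fun i _ => Submodule.smul_mem _ _ (ιMulti_mem _ _)

theorem ctr_mem_zero (u : V) {x : Ext V} (hx : x ∈ ⋀[ℝ]^0 V) : ctr u x = 0 := by
  rw [← ExteriorAlgebra.ιMulti_span_fixedDegree] at hx
  induction hx using Submodule.span_induction with
  | zero => rw [map_zero]
  | add _ _ _ _ h h' => rw [map_add, h, h', add_zero]
  | smul c _ _ h => rw [map_smul, h, smul_zero]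
  | mem x hx =>
    obtain ⟨b, rfl⟩ := hx
    exact ctr_ιMulti_zero u b

/-- Two linear maps out of the exterior algebra agree if they agree on decomposable elements. -/
theorem ext_ιMulti {N : Type*} [AddCommMonoid N] [Module ℝ N] {f g : Ext V →ₗ[ℝ] N}
    (h : ∀ n (a : Fin n → V), f (ExteriorAlgebra.ιMulti ℝ n a) = g (ExteriorAlgebra.ιMulti ℝ n a)) :
    f = g := by
  refine LinearMap.ext_on_range (v := fun x : Σ n, (Fin n → V) =>
    ExteriorAlgebra.ιMulti ℝ x.1 x.2) (ExteriorAlgebra.ιMulti_span ℝ V) fun i => h _ _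

/-- On decomposable elements this is the Laplace expansion of a Gram determinant along the column of
`u`, matched with the alternating sum in `ctr_ιMulti`. Elements of different degrees are orthogonal
on both sides. -/
theorem metric_wedge (u : V) (x y : Ext V) : metric V (wedge u x) y = metric V x (ctr u y) := by
  suffices h : (metric V).compl₁₂ (wedge u) LinearMap.id =
      (metric V).compl₁₂ LinearMap.id (ctr u) from
    congrArg (fun f : LinearMap.BilinForm ℝ (Ext V) => f x y) h
  refine ext_ιMulti fun m a => ext_ιMulti fun n b => ?_
  simp only [LinearMap.compl₁₂_apply, LinearMap.id_apply, wedge_apply]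
  have hu : ExteriorAlgebra.ι ℝ u * ExteriorAlgebra.ιMulti ℝ m a =
      ExteriorAlgebra.ιMulti ℝ (m + 1) (Fin.cons u a) := by
    rw [ExteriorAlgebra.ιMulti_succ_apply]; rfl
  rw [hu]
  rcases n with _ | n
  · rw [ctr_ιMulti_zero, map_zero]
    exact metric_eq_zero_of_mem (ιMulti_mem _ _) (ιMulti_mem _ _) (by omega)
  · by_cases h : m = n
    · subst h
      rw [metric_ιMulti, ctr_ιMulti, Matrix.det_succ_column_zero, map_sum]
      refine Finset.sum_congr rfl fun i _ => ?_
      rw [map_smul, metric_ιMulti, smul_eq_mul]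
      congr 2
    · rw [metric_eq_zero_of_mem (ιMulti_mem _ _) (ιMulti_mem _ _) (by omega),
        metric_eq_zero_of_mem (ιMulti_mem _ _) (ctr_mem u (ιMulti_mem _ _)) h]

theorem adj_unique {φ ψ : Module.End ℝ (Ext V)}
    (h : ∀ x y, metric V (ψ x) y = metric V x (φ y)) : adj φ = ψ := by
  refine LinearMap.ext fun x => sub_eq_zero.mp ((metric_nondegenerate V).1 _ fun y => ?_)
  rw [map_sub, LinearMap.sub_apply, metric_adj, h, sub_self]

theorem adj_add (φ ψ : Module.End ℝ (Ext V)) : adj (φ + ψ) = adj φ + adj ψ :=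
  adj_unique fun x y => by simp [metric_adj]

theorem adj_neg (φ : Module.End ℝ (Ext V)) : adj (-φ) = -adj φ :=
  adj_unique fun x y => by simp [metric_adj]

theorem adj_mul (φ ψ : Module.End ℝ (Ext V)) : adj (φ * ψ) = adj ψ * adj φ :=
  adj_unique fun x y => by simp [metric_adj]

theorem adj_wedge (u : V) : adj (wedge u) = ctr u :=
  adj_unique fun x y => by rw [metric_comm, ← metric_wedge, metric_comm]

theorem wedge_mul_wedge (u w : V) : wedge u * wedge w = -(wedge w * wedge u) := by
  refine LinearMap.ext fun x => ?_
  simp only [Module.End.mul_apply, LinearMap.neg_apply, wedge_apply, ← mul_assoc]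
  rw [← neg_mul, eq_neg_of_add_eq_zero_left (ExteriorAlgebra.ι_add_mul_swap u w)]

theorem ctr_mul_ctr (u w : V) : ctr u * ctr w = -(ctr w * ctr u) :=
  LinearMap.ext fun x => CliffordAlgebra.contractLeft_comm _ _ x

theorem ctr_mul_wedge (u w : V) :
    ctr u * wedge w = inner ℝ u w • 1 - wedge w * ctr u :=
  LinearMap.ext fun x => by simp [ctr_ι_mul]

variable {s : ℕ}

theorem mulLeft_ι_mul_ι (u w : V) :
    LinearMap.mulLeft ℝ (ExteriorAlgebra.ι ℝ u * ExteriorAlgebra.ι ℝ w) = wedge u * wedge w :=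
  LinearMap.ext fun _ => mul_assoc _ _ _

theorem opV_eq (v : OrthonormalBasis (Fin 2 × Fin (s + 1)) ℝ V) (j : Fin (s + 1)) :
    opV v j = wedge (v (0, j)) * wedge (v (1, j)) :=
  mulLeft_ι_mul_ι _ _

theorem opA_eq (v : OrthonormalBasis (Fin 2 × Fin (s + 1)) ℝ V) (j : Fin (s + 1)) :
    opA v j = ctr (v (1, j)) * ctr (v (0, j)) := by
  rw [opA, opV_eq, adj_mul, adj_wedge, adj_wedge]

/-- The two-forms `ω_{jk} = v_{1j} ∧ v_{1k} + v_{2j} ∧ v_{2k}` of an orthonormal coframe. -/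
def stdForm (v : OrthonormalBasis (Fin 2 × Fin (s + 1)) ℝ V) (j k : Fin (s + 1)) : Ext V :=
  ∑ i : Fin 2, ExteriorAlgebra.ι ℝ (v (i, j)) * ExteriorAlgebra.ι ℝ (v (i, k))

theorem opL_stdForm (v : OrthonormalBasis (Fin 2 × Fin (s + 1)) ℝ V) (j k : Fin (s + 1)) :
    opL (stdForm v) j k =
      wedge (v (0, j)) * wedge (v (0, k)) + wedge (v (1, j)) * wedge (v (1, k)) := by
  rw [← mulLeft_ι_mul_ι, ← mulLeft_ι_mul_ι]
  exact LinearMap.ext fun x => by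
    simp only [opL, stdForm, Fin.sum_univ_two, LinearMap.mulLeft_apply, LinearMap.add_apply,
      add_mul]

theorem opLambda_stdForm (v : OrthonormalBasis (Fin 2 × Fin (s + 1)) ℝ V) (j k : Fin (s + 1)) :
    opLambda (stdForm v) j k =
      ctr (v (0, k)) * ctr (v (0, j)) + ctr (v (1, k)) * ctr (v (1, j)) := by
  rw [opLambda, opL_stdForm, adj_add, adj_mul, adj_mul]
  simp only [adj_wedge]

end ExteriorCalculus

/-! ### Anticommutation relations and second quantization -/

section SecondQuantization

variable {A : Type*} [Ring A]

/-- The anticommutator. -/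
def anticomm (x y : A) : A := x * y + y * x

theorem anticomm_comm (x y : A) : anticomm x y = anticomm y x := add_comm _ _

theorem anticomm_add_left (x y z : A) : anticomm (x + y) z = anticomm x z + anticomm y z := by
  simp only [anticomm]; noncomm_ring

theorem anticomm_add_right (x y z : A) : anticomm x (y + z) = anticomm x y + anticomm x z := by
  simp only [anticomm]; noncomm_ring

theorem anticomm_sub_left (x y z : A) : anticomm (x - y) z = anticomm x z - anticomm y z := by
  simp only [anticomm]; noncomm_ring

theorem anticomm_sub_right (x y z : A) : anticomm x (y - z) = anticomm x y - anticomm x z := by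
  simp only [anticomm]; noncomm_ring

variable [Algebra ℂ A]

theorem anticomm_smul_left (c : ℂ) (x y : A) : anticomm (c • x) y = c • anticomm x y := by
  simp [anticomm]

theorem anticomm_smul_right (c : ℂ) (x y : A) : anticomm x (c • y) = c • anticomm x y := by
  simp [anticomm]

theorem anticomm_sum_right {ι : Type*} (t : Finset ι) (x : A) (f : ι → A) :
    anticomm x (∑ i ∈ t, f i) = ∑ i ∈ t, anticomm x (f i) := by
  simp [anticomm, Finset.mul_sum, Finset.sum_mul, Finset.sum_add_distrib]

/-- The canonical anticommutation relations between creation operators `c` and annihilation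
operators `d`. -/
structure IsCAR {ι : Type*} [DecidableEq ι] (c d : ι → A) : Prop where
  cc : ∀ a b, anticomm (c a) (c b) = 0
  dd : ∀ a b, anticomm (d a) (d b) = 0
  dc : ∀ a b, anticomm (d a) (c b) = if a = b then 1 else 0

variable {ι : Type*} [Fintype ι] [DecidableEq ι]

/-- The second quantization `∑ X_{ab} c_a d_b` of a matrix `X`. -/
def secondQuant (c d : ι → A) : Matrix ι ι ℂ →ₗ[ℂ] A where
  toFun X := ∑ a, ∑ b, X a b • (c a * d b)
  map_add' X Y := by simp [add_smul, Finset.sum_add_distrib]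
  map_smul' r X := by simp [mul_smul, Finset.smul_sum]

theorem secondQuant_apply (c d : ι → A) (X : Matrix ι ι ℂ) :
    secondQuant c d X = ∑ a, ∑ b, X a b • (c a * d b) := rfl

theorem secondQuant_single (c d : ι → A) (a b : ι) (z : ℂ) :
    secondQuant c d (Matrix.single a b z) = z • (c a * d b) := by
  rw [secondQuant_apply, Finset.sum_eq_single a, Finset.sum_eq_single b]
  · simp
  · intro b' _ hb; simp [Matrix.single, hb.symm]
  · simp
  · intro a' _ ha; simp [Matrix.single, ha.symm]
  · simp

namespace IsCAR

variable {c d : ι → A} (h : IsCAR c d)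
include h

theorem lie_c (X : Matrix ι ι ℂ) (e : ι) :
    secondQuant c d X * c e - c e * secondQuant c d X = ∑ a, X a e • c a := by
  -- A commutator of a quadratic with a linear expression reduces to anticommutators, which are
  -- scalars.
  have key : ∀ a b, c a * d b * c e - c e * (c a * d b) = if b = e then c a else 0 := by
    intro a b
    have h1 := h.dc b e
    have h2 := h.cc a e
    have : c a * d b * c e - c e * (c a * d b) =
        c a * anticomm (d b) (c e) - anticomm (c a) (c e) * d b := by
      simp only [anticomm]; noncomm_ring
    rw [this, h1, h2]
    split_ifs <;> simp
  simp only [secondQuant_apply, Finset.sum_mul, Finset.mul_sum, ← Finset.sum_sub_distrib,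
    smul_mul_assoc, mul_smul_comm, ← smul_sub, key]
  simp

theorem lie_d (X : Matrix ι ι ℂ) (e : ι) :
    secondQuant c d X * d e - d e * secondQuant c d X = -∑ b, X e b • d b := by
  have key : ∀ a b, c a * d b * d e - d e * (c a * d b) = if e = a then -d b else 0 := by
    intro a b
    have h1 := h.dc e a
    have h2 := h.dd b e
    have : c a * d b * d e - d e * (c a * d b) =
        c a * anticomm (d b) (d e) - anticomm (d e) (c a) * d b := by
      simp only [anticomm]; noncomm_ring
    rw [this, h1, h2]
    split_ifs <;> simp
  simp only [secondQuant_apply, Finset.sum_mul, Finset.mul_sum, ← Finset.sum_sub_distrib,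
    smul_mul_assoc, mul_smul_comm, ← smul_sub, key]
  rw [Finset.sum_comm]
  simp

/-- The commutator with the second quantization of `X` is a derivation that acts on the creation
operators by `X` and on the annihilation operators by minus its transpose. -/
theorem secondQuant_lie (X Y : Matrix ι ι ℂ) :
    secondQuant c d (X * Y - Y * X) =
      secondQuant c d X * secondQuant c d Y - secondQuant c d Y * secondQuant c d X := by
  have key : ∀ e f, secondQuant c d X * (c e * d f) - c e * d f * secondQuant c d X =
      ∑ a, X a e • (c a * d f) - ∑ b, X f b • (c e * d b) := by
    intro e f
    have : secondQuant c d X * (c e * d f) - c e * d f * secondQuant c d X =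
        (secondQuant c d X * c e - c e * secondQuant c d X) * d f +
          c e * (secondQuant c d X * d f - d f * secondQuant c d X) := by noncomm_ring
    rw [this, h.lie_c, h.lie_d, Finset.sum_mul, mul_neg, Finset.mul_sum, ← sub_eq_add_neg]
    simp only [smul_mul_assoc, mul_smul_comm]
  have hY : secondQuant c d X * secondQuant c d Y - secondQuant c d Y * secondQuant c d X =
      ∑ e, ∑ f, Y e f • (secondQuant c d X * (c e * d f) - c e * d f * secondQuant c d X) := by
    rw [secondQuant_apply c d Y]
    simp only [Finset.sum_mul, Finset.mul_sum, ← Finset.sum_sub_distrib,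
      smul_mul_assoc, mul_smul_comm, ← smul_sub]
  rw [hY, map_sub]
  simp only [key, smul_sub, Finset.sum_sub_distrib, Finset.smul_sum, smul_smul]
  congr 1
  · simp only [secondQuant_apply, Matrix.mul_apply, Finset.sum_smul]
    calc ∑ a, ∑ f, ∑ e, (X a e * Y e f) • (c a * d f)
        = ∑ a, ∑ e, ∑ f, (X a e * Y e f) • (c a * d f) :=
          Finset.sum_congr rfl fun a _ => Finset.sum_comm
      _ = ∑ e, ∑ a, ∑ f, (X a e * Y e f) • (c a * d f) := Finset.sum_comm
      _ = ∑ e, ∑ f, ∑ a, (X a e * Y e f) • (c a * d f) :=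
          Finset.sum_congr rfl fun e _ => Finset.sum_comm
      _ = ∑ e, ∑ f, ∑ a, (Y e f * X a e) • (c a * d f) := by simp only [mul_comm]
  · simp only [secondQuant_apply, Matrix.mul_apply, Finset.sum_smul]
    exact Finset.sum_congr rfl fun e _ => Finset.sum_comm

/-- The entry `X b e` is recovered as the anticommutator of `d b` with the commutator of the second
quantization and `c e`. -/
theorem secondQuant_injective [Nontrivial A] : Function.Injective (secondQuant c d) := by
  rw [injective_iff_map_eq_zero]
  intro X hX
  ext b e
  have h1 := h.lie_c X e
  rw [hX, zero_mul, mul_zero, sub_zero] at h1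
  have h2 : anticomm (d b) (∑ a, X a e • c a) = X b e • 1 := by
    simp [anticomm_sum_right, anticomm_smul_right, h.dc]
  rw [← h1] at h2
  have h3 : X b e • (1 : A) = 0 := by rw [← h2]; simp [anticomm]
  simpa using h3

end IsCAR

variable {n : Type*} [Fintype n] [DecidableEq n]

/-- The creation operators of the charge eigenstates of a complex fermion with two real
components `(0, j)` and `(1, j)`. -/
def chargedCreation (e f : Fin 2 × n → A) : n ⊕ n → A :=
  Sum.elim (fun j => (1 / 2 : ℂ) • (e (0, j) + Complex.I • e (1, j)))
    (fun j => (1 / 2 : ℂ) • (f (0, j) + Complex.I • f (1, j)))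

/-- The annihilation operators that correspond to `chargedCreation`. -/
def chargedAnnihilation (e f : Fin 2 × n → A) : n ⊕ n → A :=
  Sum.elim (fun j => f (0, j) - Complex.I • f (1, j)) (fun j => e (0, j) - Complex.I • e (1, j))

/-- The factor 1/2 sits on the creation operators only, so that each mode pairs to (1 + 1)/2 = 1.
The remaining pairings cancel because i² = -1. -/
theorem IsCAR.charged {e f : Fin 2 × n → A} (h : IsCAR e f) :
    IsCAR (chargedCreation e f) (chargedAnnihilation e f) := by
  have hcd : ∀ p q, anticomm (e p) (f q) = if q = p then 1 else 0 := fun p q => by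
    rw [anticomm_comm, h.dc]
  have hI : (2⁻¹ * 2⁻¹ : ℂ) + 2⁻¹ * (Complex.I * (2⁻¹ * Complex.I)) = 0 := by
    linear_combination (1 / 4 : ℂ) * Complex.I_sq
  constructor <;> rintro (j | j) (k | k) <;>
    simp only [chargedCreation, chargedAnnihilation, Sum.elim_inl, Sum.elim_inr, anticomm_add_left,
      anticomm_add_right, anticomm_sub_left, anticomm_sub_right, anticomm_smul_left,
      anticomm_smul_right, h.cc, h.dd, h.dc, hcd, Prod.mk.injEq] <;>
    by_cases hjk : j = k <;> simp [hjk, eq_comm, smul_smul]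
  · rw [← add_smul, hI, zero_smul]
  · rw [← add_smul, hI, zero_smul]
  · rw [← add_smul]; norm_num
  · rw [← add_smul]; norm_num

end SecondQuantization

/-! ### Generating the special unitary algebra of the swap form -/

section SplitUnitary

open Matrix

variable {n : Type*} [Fintype n] [DecidableEq n]

/-- The matrix that exchanges the two summands. -/
def swapMatrix (n : Type*) [DecidableEq n] : Matrix (n ⊕ n) (n ⊕ n) ℂ := fromBlocks 0 1 1 0

/-- The block matrix with the upper right block `K`. -/
def blockUp (K : Matrix n n ℂ) : Matrix (n ⊕ n) (n ⊕ n) ℂ := fromBlocks 0 K 0 0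

/-- The block matrix with the lower left block `K`. -/
def blockLow (K : Matrix n n ℂ) : Matrix (n ⊕ n) (n ⊕ n) ℂ := fromBlocks 0 0 K 0

/-- The block diagonal matrix with the blocks `A` and `-Aᴴ`. -/
def blockDiag (A : Matrix n n ℂ) : Matrix (n ⊕ n) (n ⊕ n) ℂ := fromBlocks A 0 0 (-Aᴴ)

theorem lie_blockUp_blockLow (K K' : Matrix n n ℂ) :
    ⁅blockUp K, blockLow K'⁆ = fromBlocks (K * K') 0 0 (-(K' * K)) := by
  simp [Ring.lie_def, blockUp, blockLow, fromBlocks_multiply, sub_eq_add_neg, fromBlocks_neg,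
    fromBlocks_add]

theorem lie_blockDiag_blockUp (A K : Matrix n n ℂ) :
    ⁅blockDiag A, blockUp K⁆ = blockUp (A * K + K * Aᴴ) := by
  simp [Ring.lie_def, blockUp, blockDiag, fromBlocks_multiply, sub_eq_add_neg, fromBlocks_neg,
    fromBlocks_add]

theorem lie_blockDiag_blockLow (A K : Matrix n n ℂ) :
    ⁅blockDiag A, blockLow K⁆ = blockLow (-(Aᴴ * K + K * A)) := by
  simp [Ring.lie_def, blockLow, blockDiag, fromBlocks_multiply, sub_eq_add_neg, fromBlocks_neg,
    fromBlocks_add, add_comm]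

theorem lie_blockDiag_blockDiag (A A' : Matrix n n ℂ) :
    ⁅blockDiag A, blockDiag A'⁆ = blockDiag (A * A' - A' * A) := by
  simp [Ring.lie_def, blockDiag, fromBlocks_multiply, sub_eq_add_neg, fromBlocks_neg,
    fromBlocks_add]

/-- The generators of the special unitary Lie algebra of the swap matrix. -/
def splitGenerators (n : Type*) [DecidableEq n] : Set (Matrix (n ⊕ n) (n ⊕ n) ℂ) :=
  {X | (∃ j k, j ≠ k ∧ (X = blockUp (single j k 1 - single k j 1) ∨
      X = blockLow (single k j 1 - single j k 1))) ∨
    ∃ j, X = blockUp (single j j Complex.I) ∨ X = blockLow (single j j (-Complex.I))}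

/-- The traceless complex matrices that are anti-Hermitian for the swap matrix. -/
def splitSU (n : Type*) [Fintype n] [DecidableEq n] :
    LieSubalgebra ℝ (Matrix (n ⊕ n) (n ⊕ n) ℂ) where
  carrier := {X | X.trace = 0 ∧ Xᴴ * swapMatrix n + swapMatrix n * X = 0}
  add_mem' := by
    rintro X Y ⟨hX, hX'⟩ ⟨hY, hY'⟩
    refine ⟨by rw [trace_add, hX, hY, add_zero], ?_⟩
    rw [conjTranspose_add, add_mul, mul_add, add_add_add_comm, hX', hY', add_zero]
  zero_mem' := by simp
  smul_mem' := by
    rintro c X ⟨hX, hX'⟩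
    refine ⟨by rw [trace_smul, hX, smul_zero], ?_⟩
    rw [conjTranspose_smul, star_trivial, Matrix.smul_mul, Matrix.mul_smul, ← smul_add, hX', smul_zero]
  lie_mem' := by
    rintro X Y ⟨hX, hX'⟩ ⟨hY, hY'⟩
    refine ⟨by rw [Ring.lie_def, trace_sub, trace_mul_comm, sub_self], ?_⟩
    have h1 := eq_neg_of_add_eq_zero_left hX'
    have h2 := eq_neg_of_add_eq_zero_left hY'
    rw [Ring.lie_def, conjTranspose_sub, conjTranspose_mul, conjTranspose_mul, sub_mul,
      Matrix.mul_assoc, Matrix.mul_assoc, h1, h2, mul_neg, mul_neg, ← Matrix.mul_assoc,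
      ← Matrix.mul_assoc, h1, h2]
    noncomm_ring

theorem mem_splitSU {X : Matrix (n ⊕ n) (n ⊕ n) ℂ} :
    X ∈ splitSU n ↔ X.trace = 0 ∧ Xᴴ * swapMatrix n + swapMatrix n * X = 0 := Iff.rfl

theorem fromBlocks_mem_splitSU (A B C D : Matrix n n ℂ) :
    fromBlocks A B C D ∈ splitSU n ↔
      A.trace + D.trace = 0 ∧ D = -Aᴴ ∧ Bᴴ = -B ∧ Cᴴ = -C := by
  have htr : (fromBlocks A B C D).trace = A.trace + D.trace := by simp [Matrix.trace]
  rw [mem_splitSU, htr, fromBlocks_conjTranspose, swapMatrix, fromBlocks_multiply,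
    fromBlocks_multiply, fromBlocks_add, ← fromBlocks_zero, fromBlocks_inj]
  simp only [Matrix.mul_zero, Matrix.mul_one, Matrix.zero_mul, Matrix.one_mul, zero_add, add_zero]
  constructor
  · rintro ⟨h, h1, h2, h3, h4⟩
    exact ⟨h, eq_neg_of_add_eq_zero_right h2, eq_neg_of_add_eq_zero_left h4,
      eq_neg_of_add_eq_zero_left h1⟩
  · rintro ⟨h, rfl, h1, h2⟩
    exact ⟨h, by simp [h1, h2]⟩

theorem splitGenerators_subset : splitGenerators n ⊆ splitSU n := by
  rintro X (⟨j, k, -, rfl | rfl⟩ | ⟨j, rfl | rfl⟩) <;>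
  · rw [SetLike.mem_coe]
    first | rw [blockUp] | rw [blockLow]
    rw [fromBlocks_mem_splitSU]
    simp [conjTranspose_single, single_neg]

variable {K : LieSubalgebra ℝ (Matrix (n ⊕ n) (n ⊕ n) ℂ)} (hK : splitGenerators n ⊆ K)
include hK

theorem blockUp_mem {j k : n} (h : j ≠ k) : blockUp (single j k 1 - single k j 1) ∈ K :=
  hK (Or.inl ⟨j, k, h, Or.inl rfl⟩)

theorem blockLow_mem {j k : n} (h : j ≠ k) : blockLow (single j k 1 - single k j 1) ∈ K :=
  hK (Or.inl ⟨k, j, h.symm, Or.inr rfl⟩)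

theorem blockUp_diag_mem (j : n) : blockUp (single j j Complex.I) ∈ K :=
  hK (Or.inr ⟨j, Or.inl rfl⟩)

theorem blockLow_diag_mem (j : n) : blockLow (single j j (-Complex.I)) ∈ K :=
  hK (Or.inr ⟨j, Or.inr rfl⟩)

/-- The product (E_jk - E_kj)(-i E_kk) is -i E_jk, since E_kj E_kk = 0. -/
theorem blockDiag_single_I_mem {j k : n} (h : j ≠ k) :
    blockDiag (single j k Complex.I) ∈ K := by
  have := K.neg_mem (K.lie_mem (blockUp_mem hK h) (blockLow_diag_mem hK k))
  rw [lie_blockUp_blockLow] at this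
  convert this using 1
  simp [blockDiag, fromBlocks_neg, sub_mul, mul_sub, h, h.symm, conjTranspose_single, single_neg]

theorem blockDiag_single_self_mem (j : n) : blockDiag (single j j (1 : ℂ)) ∈ K := by
  have := K.lie_mem (blockUp_diag_mem hK j) (blockLow_diag_mem hK j)
  rw [lie_blockUp_blockLow] at this
  convert this using 1
  simp [blockDiag, conjTranspose_single]

variable (hn : ∀ j k : n, ∃ l, l ≠ j ∧ l ≠ k)
include hn

/-- For `j ≠ k` a third index `l` is needed: (E_jl - E_lj)(E_lk - E_kl) = E_jk. With only two
indices the real off-diagonal units do not arise in this way. -/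
theorem blockDiag_single_mem (j k : n) : blockDiag (single j k (1 : ℂ)) ∈ K := by
  by_cases h : j = k
  · exact h ▸ blockDiag_single_self_mem hK j
  obtain ⟨l, hj, hk⟩ := hn j k
  have := K.lie_mem (blockUp_mem hK hj.symm) (blockLow_mem hK hk)
  rw [lie_blockUp_blockLow] at this
  convert this using 1
  simp [blockDiag, sub_mul, mul_sub, h, Ne.symm h, hj, hj.symm, hk, hk.symm, conjTranspose_single]

theorem blockUp_single_add_mem (j k : n) :
    blockUp (single j k Complex.I + single k j Complex.I) ∈ K := by
  have := K.lie_mem (blockDiag_single_mem hK hn j k) (blockUp_diag_mem hK k)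
  rw [lie_blockDiag_blockUp] at this
  convert this using 1
  simp [conjTranspose_single]

theorem blockLow_single_add_mem (j k : n) :
    blockLow (single j k Complex.I + single k j Complex.I) ∈ K := by
  have := K.lie_mem (blockDiag_single_mem hK hn k j) (blockLow_diag_mem hK k)
  rw [lie_blockDiag_blockLow] at this
  convert this using 1
  simp [conjTranspose_single, single_neg, add_comm]

theorem blockDiag_single_I_sub_mem (j k : n) :
    blockDiag (single j j Complex.I - single k k Complex.I) ∈ K := by
  by_cases h : j = k
  · subst h
    simp [blockDiag]
  -- This is [i E_jk, E_kj] = i(E_jj - E_kk).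
  have := K.lie_mem (blockDiag_single_I_mem hK h) (blockDiag_single_mem hK hn k j)
  rw [lie_blockDiag_blockDiag] at this
  convert this using 1
  simp

omit hK hn in
theorem skewHermitian_eq_sum {B : Matrix n n ℂ} (hB : Bᴴ = -B) :
    B = (1 / 2 : ℝ) • ∑ j, ∑ k, ((B j k).re • (single j k (1 : ℂ) - single k j 1) +
      (B j k).im • (single j k Complex.I + single k j Complex.I)) := by
  -- Skew-symmetrizing the expansion of `B` in matrix units turns it into a real combination of
  -- elements already known to be available.
  have h2 : B = (1 / 2 : ℝ) • (B - Bᴴ) := by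
    rw [hB, sub_neg_eq_add, ← two_smul ℝ, smul_smul]; norm_num
  conv_lhs => rw [h2, matrix_eq_sum_single B]
  congr 1
  rw [conjTranspose_sum]
  simp only [conjTranspose_sum, ← Finset.sum_sub_distrib, conjTranspose_single]
  refine Finset.sum_congr rfl fun j _ => Finset.sum_congr rfl fun k _ => ?_
  have hre : ∀ z : ℂ, z = z.re • (1 : ℂ) + z.im • Complex.I := fun z => by
    apply Complex.ext <;> simp
  have hst : ∀ z : ℂ, star z = z.re • (1 : ℂ) - z.im • Complex.I := fun z => by
    apply Complex.ext <;> simp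
  rw [hst (B j k), congrArg (single j k) (hre (B j k))]
  have hsub : ∀ x y : ℂ, single k j (x - y) = single k j x - single k j y := fun x y => by
    simp only [sub_eq_add_neg, single_add, single_neg]
  simp only [single_add, hsub, ← smul_single, smul_add, smul_sub]
  abel

theorem blockUp_skew_mem {B : Matrix n n ℂ} (hB : Bᴴ = -B) : blockUp B ∈ K := by
  let f : Matrix n n ℂ →ₗ[ℝ] Matrix (n ⊕ n) (n ⊕ n) ℂ :=
    { toFun := blockUp
      map_add' := fun X Y => by simp [blockUp, fromBlocks_add]
      map_smul' := fun c X => by simp [blockUp, fromBlocks_smul] }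
  suffices B ∈ K.toSubmodule.comap f from this
  rw [skewHermitian_eq_sum hB]
  refine Submodule.smul_mem _ _ (Submodule.sum_mem _ fun j _ => Submodule.sum_mem _ fun k _ =>
    Submodule.add_mem _ (Submodule.smul_mem _ _ ?_) (Submodule.smul_mem _ _ ?_))
  · by_cases h : j = k
    · rw [h, sub_self]; exact zero_mem _
    · exact blockUp_mem hK h
  · exact blockUp_single_add_mem hK hn j k

theorem blockLow_skew_mem {B : Matrix n n ℂ} (hB : Bᴴ = -B) : blockLow B ∈ K := by
  let f : Matrix n n ℂ →ₗ[ℝ] Matrix (n ⊕ n) (n ⊕ n) ℂ :=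
    { toFun := blockLow
      map_add' := fun X Y => by simp [blockLow, fromBlocks_add]
      map_smul' := fun c X => by simp [blockLow, fromBlocks_smul] }
  suffices B ∈ K.toSubmodule.comap f from this
  rw [skewHermitian_eq_sum hB]
  refine Submodule.smul_mem _ _ (Submodule.sum_mem _ fun j _ => Submodule.sum_mem _ fun k _ =>
    Submodule.add_mem _ (Submodule.smul_mem _ _ ?_) (Submodule.smul_mem _ _ ?_))
  · by_cases h : j = k
    · rw [h, sub_self]; exact zero_mem _
    · exact blockLow_mem hK h
  · exact blockLow_single_add_mem hK hn j k

theorem blockDiag_mem [Nonempty n] {A : Matrix n n ℂ} (hA : A.trace.im = 0) :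
    blockDiag A ∈ K := by
  let f : Matrix n n ℂ →ₗ[ℝ] Matrix (n ⊕ n) (n ⊕ n) ℂ :=
    { toFun := blockDiag
      map_add' := fun X Y => by simp [blockDiag, fromBlocks_add, add_comm]
      map_smul' := fun c X => by simp [blockDiag, fromBlocks_smul] }
  suffices A ∈ K.toSubmodule.comap f from this
  let l : n := Classical.arbitrary n
  -- The units i E_jj are available only as differences. Subtracting a fixed i E_ll from each
  -- changes the sum by (Im tr `A`) i E_ll, which is zero.
  have hAs : A = ∑ j, ∑ k, ((A j k).re • single j k (1 : ℂ) + (A j k).im •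
      (single j k Complex.I - if j = k then single l l Complex.I else 0)) := by
    have h0 : ∑ j, ∑ k, (A j k).im • (if j = k then single l l Complex.I else 0 : Matrix n n ℂ) =
        0 := by
      simp only [smul_ite, smul_zero, Finset.sum_ite_eq, Finset.mem_univ, if_true]
      rw [← Finset.sum_smul]
      have : ∑ j, (A j j).im = A.trace.im := by simp [Matrix.trace]
      rw [this, hA, zero_smul]
    simp only [smul_sub, ← add_sub_assoc, Finset.sum_sub_distrib, h0, sub_zero]
    conv_lhs => rw [matrix_eq_sum_single A]
    refine Finset.sum_congr rfl fun j _ => Finset.sum_congr rfl fun k _ => ?_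
    rw [smul_single, smul_single, ← single_add]
    congr 1
    apply Complex.ext <;> simp
  rw [hAs]
  refine Submodule.sum_mem _ fun j _ => Submodule.sum_mem _ fun k _ =>
    Submodule.add_mem _ (Submodule.smul_mem _ _ ?_) (Submodule.smul_mem _ _ ?_)
  · exact blockDiag_single_mem hK hn j k
  · split_ifs with h
    · subst h; exact blockDiag_single_I_sub_mem hK hn j l
    · rw [sub_zero]; exact blockDiag_single_I_mem hK h

omit hK in
theorem lieSpan_splitGenerators [Nonempty n] :
    LieSubalgebra.lieSpan ℝ _ (splitGenerators n) = splitSU n := by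
  refine le_antisymm (LieSubalgebra.lieSpan_le.mpr splitGenerators_subset) fun X hX => ?_
  have hK : splitGenerators n ⊆ LieSubalgebra.lieSpan ℝ _ (splitGenerators n) :=
    LieSubalgebra.subset_lieSpan
  rw [← fromBlocks_toBlocks X] at hX ⊢
  obtain ⟨h, hD, hB, hC⟩ := (fromBlocks_mem_splitSU _ _ _ _).mp hX
  -- The lower diagonal block is minus the adjoint of the upper one, so the full trace is 2i times
  -- this imaginary part.
  have hA : (toBlocks₁₁ X).trace.im = 0 := by
    rw [hD, trace_neg, trace_conjTranspose] at h
    have := congrArg Complex.im h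
    simp at this
    linarith
  have : fromBlocks X.toBlocks₁₁ X.toBlocks₁₂ X.toBlocks₂₁ X.toBlocks₂₂ =
      blockDiag X.toBlocks₁₁ + blockUp X.toBlocks₁₂ + blockLow X.toBlocks₂₁ := by
    rw [hD]; simp [blockDiag, blockUp, blockLow, fromBlocks_add]
  rw [this]
  exact add_mem (add_mem (blockDiag_mem hK hn hA) (blockUp_skew_mem hK hn hB))
    (blockLow_skew_mem hK hn hC)

end SplitUnitary

/-! ### From the swap form to the diagonal form of signature (m, m) -/

section CayleyTransform

open Matrix

variable {m : ℕ}

/-- The (unnormalized) Cayley matrix, which intertwines the swap and the signature matrix. -/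
def cayleyMatrix (m : ℕ) : Matrix (Fin m ⊕ Fin m) (Fin m ⊕ Fin m) ℂ := fromBlocks 1 1 1 (-1)

theorem signatureMatrix_eq : signatureMatrix m m = fromBlocks 1 0 0 (-1) := by
  ext (a | a) (b | b) <;> simp [signatureMatrix, diagonal_apply, one_apply, apply_ite]

theorem cayley_mul_cayley : cayleyMatrix m * cayleyMatrix m = (2 : ℂ) • 1 := by
  rw [cayleyMatrix, fromBlocks_multiply, ← fromBlocks_one, fromBlocks_smul]
  simp [two_smul]

theorem cayley_mul_signature :
    cayleyMatrix m * signatureMatrix m m = swapMatrix (Fin m) * cayleyMatrix m := by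
  rw [cayleyMatrix, signatureMatrix_eq, swapMatrix, fromBlocks_multiply, fromBlocks_multiply]
  simp

theorem signature_mul_cayley :
    signatureMatrix m m * cayleyMatrix m = cayleyMatrix m * swapMatrix (Fin m) := by
  rw [cayleyMatrix, signatureMatrix_eq, swapMatrix, fromBlocks_multiply, fromBlocks_multiply]
  simp

theorem cayley_conjTranspose : (cayleyMatrix m)ᴴ = cayleyMatrix m := by
  simp [cayleyMatrix, fromBlocks_conjTranspose]

/-- Conjugation by the Cayley matrix. -/
def cayley (m : ℕ) : Matrix (Fin m ⊕ Fin m) (Fin m ⊕ Fin m) ℂ →ₗ⁅ℝ⁆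
    Matrix (Fin m ⊕ Fin m) (Fin m ⊕ Fin m) ℂ where
  toFun X := (1 / 2 : ℂ) • (cayleyMatrix m * X * cayleyMatrix m)
  map_add' X Y := by rw [mul_add, add_mul, smul_add]
  map_smul' r X := by
    rw [Matrix.mul_smul, Matrix.smul_mul, smul_comm, RingHom.id_apply]
  map_lie' := by
    intro X Y
    have h : ∀ X Y : Matrix (Fin m ⊕ Fin m) (Fin m ⊕ Fin m) ℂ,
        ((1 / 2 : ℂ) • (cayleyMatrix m * X * cayleyMatrix m)) *
          ((1 / 2 : ℂ) • (cayleyMatrix m * Y * cayleyMatrix m)) =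
        (1 / 2 : ℂ) • (cayleyMatrix m * (X * Y) * cayleyMatrix m) := by
      intro X Y
      have : cayleyMatrix m * X * cayleyMatrix m * (cayleyMatrix m * Y * cayleyMatrix m) =
          cayleyMatrix m * X * (cayleyMatrix m * cayleyMatrix m) * Y * cayleyMatrix m := by
        noncomm_ring
      rw [Matrix.smul_mul, Matrix.mul_smul, this, cayley_mul_cayley]
      simp only [Matrix.mul_smul, Matrix.smul_mul, Matrix.mul_one, smul_smul, Matrix.mul_assoc]
      norm_num
    simp only [Ring.lie_def]
    rw [h, h, mul_sub, sub_mul, smul_sub]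

theorem cayley_apply (X : Matrix (Fin m ⊕ Fin m) (Fin m ⊕ Fin m) ℂ) :
    cayley m X = (1 / 2 : ℂ) • (cayleyMatrix m * X * cayleyMatrix m) := rfl

theorem cayley_cayley (X : Matrix (Fin m ⊕ Fin m) (Fin m ⊕ Fin m) ℂ) :
    cayley m (cayley m X) = X := by
  rw [cayley_apply, cayley_apply]
  have : cayleyMatrix m * (cayleyMatrix m * X * cayleyMatrix m) * cayleyMatrix m =
      (cayleyMatrix m * cayleyMatrix m) * X * (cayleyMatrix m * cayleyMatrix m) := by noncomm_ring
  rw [Matrix.mul_smul, Matrix.smul_mul, this, cayley_mul_cayley]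
  simp only [Matrix.mul_smul, Matrix.smul_mul, Matrix.mul_one, Matrix.one_mul, smul_smul]
  norm_num

theorem cayley_injective : Function.Injective (cayley m) :=
  Function.LeftInverse.injective cayley_cayley

theorem trace_cayley (X : Matrix (Fin m ⊕ Fin m) (Fin m ⊕ Fin m) ℂ) :
    (cayley m X).trace = X.trace := by
  rw [cayley_apply, trace_smul, trace_mul_comm, ← Matrix.mul_assoc, cayley_mul_cayley,
    Matrix.smul_mul, Matrix.one_mul, trace_smul, smul_smul]
  norm_num

theorem conjTranspose_cayley (X : Matrix (Fin m ⊕ Fin m) (Fin m ⊕ Fin m) ℂ) :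
    (cayley m X)ᴴ = cayley m Xᴴ := by
  rw [cayley_apply, cayley_apply, conjTranspose_smul, conjTranspose_mul, conjTranspose_mul,
    cayley_conjTranspose, Matrix.mul_assoc]
  simp

theorem cayley_mem_splitSU {X : Matrix (Fin m ⊕ Fin m) (Fin m ⊕ Fin m) ℂ} (hX : X ∈ su m m) :
    cayley m X ∈ splitSU (Fin m) := by
  refine ⟨(trace_cayley X).trans hX.1, ?_⟩
  rw [conjTranspose_cayley, cayley_apply, cayley_apply, Matrix.smul_mul, Matrix.mul_smul,
    ← smul_add, Matrix.mul_assoc (_ * _), ← signature_mul_cayley, ← Matrix.mul_assoc (swapMatrix _),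
    ← Matrix.mul_assoc (swapMatrix _), ← cayley_mul_signature]
  have : cayleyMatrix m * Xᴴ * (signatureMatrix m m * cayleyMatrix m) +
      cayleyMatrix m * signatureMatrix m m * X * cayleyMatrix m =
      cayleyMatrix m * (Xᴴ * signatureMatrix m m + signatureMatrix m m * X) * cayleyMatrix m := by
    noncomm_ring
  rw [this, hX.2]
  simp

theorem cayley_mem_su {X : Matrix (Fin m ⊕ Fin m) (Fin m ⊕ Fin m) ℂ} (hX : X ∈ splitSU (Fin m)) :
    cayley m X ∈ su m m := by
  refine ⟨(trace_cayley X).trans hX.1, ?_⟩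
  rw [conjTranspose_cayley, cayley_apply, cayley_apply, Matrix.smul_mul, Matrix.mul_smul,
    ← smul_add, Matrix.mul_assoc (_ * _), cayley_mul_signature,
    ← Matrix.mul_assoc (signatureMatrix m m),
    ← Matrix.mul_assoc (signatureMatrix m m), signature_mul_cayley]
  have : cayleyMatrix m * Xᴴ * (swapMatrix (Fin m) * cayleyMatrix m) +
      cayleyMatrix m * swapMatrix (Fin m) * X * cayleyMatrix m =
      cayleyMatrix m * (Xᴴ * swapMatrix (Fin m) + swapMatrix (Fin m) * X) * cayleyMatrix m := by
    noncomm_ring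
  rw [this, hX.2]
  simp

theorem map_cayley_su : (su m m).map (cayley m) = splitSU (Fin m) := by
  ext X
  rw [LieSubalgebra.mem_map]
  constructor
  · rintro ⟨Y, hY, rfl⟩
    exact cayley_mem_splitSU hY
  · exact fun hX => ⟨cayley m X, cayley_mem_su hX, cayley_cayley X⟩

end CayleyTransform

/-! ### Second quantized matrices of the generators -/

section ChargedGenerators

open Matrix

variable {A : Type*} [Ring A] [Algebra ℂ A] {n : Type*} [Fintype n] [DecidableEq n]

theorem blockUp_single (j k : n) (z : ℂ) :
    blockUp (single j k z) = single (Sum.inl j) (Sum.inr k) z := by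
  ext (a | a) (b | b) <;> simp [blockUp, single]

theorem blockLow_single (j k : n) (z : ℂ) :
    blockLow (single j k z) = single (Sum.inr j) (Sum.inl k) z := by
  ext (a | a) (b | b) <;> simp [blockLow, single]

theorem blockUp_sub (K K' : Matrix n n ℂ) : blockUp (K - K') = blockUp K - blockUp K' := by
  ext (a | a) (b | b) <;> simp [blockUp]

theorem blockLow_sub (K K' : Matrix n n ℂ) : blockLow (K - K') = blockLow K - blockLow K' := by
  ext (a | a) (b | b) <;> simp [blockLow]

/-- For products of two wedges, or of two contractions, the first summand is antisymmetric in the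
mode indices and the second symmetric. Antisymmetrizing thus isolates L_jk and Λ_jk, while the
diagonal isolates V_j and A_j. -/
theorem charged_mul (a b c d : A) :
    ((1 / 2 : ℂ) • (a + Complex.I • b)) * (c - Complex.I • d) =
      (1 / 2 : ℂ) • (a * c + b * d) + (Complex.I / 2) • (b * c - a * d) := by
  have h : (1 / 2 : ℂ) • (b * d) = (-(1 / 2 * (Complex.I * Complex.I))) • (b * d) := by
    rw [Complex.I_mul_I]; norm_num
  rw [smul_add _ (a * c), h]
  simp only [mul_sub, add_mul, smul_mul_assoc, mul_smul_comm, smul_add, smul_sub, smul_smul]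
  module

variable {e f : Fin 2 × n → A} (h : IsCAR e f)

/-- The second quantization in terms of the charged operators. -/
def chargedQuant (e f : Fin 2 × n → A) : Matrix (n ⊕ n) (n ⊕ n) ℂ →ₗ[ℂ] A :=
  secondQuant (chargedCreation e f) (chargedAnnihilation e f)

theorem chargedQuant_up (j k : n) (z : ℂ) : chargedQuant e f (blockUp (single j k z)) =
    z • ((1 / 2 : ℂ) • (e (0, j) * e (0, k) + e (1, j) * e (1, k)) +
      (Complex.I / 2) • (e (1, j) * e (0, k) - e (0, j) * e (1, k))) := by
  rw [blockUp_single, chargedQuant, secondQuant_single, ← charged_mul]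
  rfl

theorem chargedQuant_low (j k : n) (z : ℂ) : chargedQuant e f (blockLow (single j k z)) =
    z • ((1 / 2 : ℂ) • (f (0, j) * f (0, k) + f (1, j) * f (1, k)) +
      (Complex.I / 2) • (f (1, j) * f (0, k) - f (0, j) * f (1, k))) := by
  rw [blockLow_single, chargedQuant, secondQuant_single, ← charged_mul]
  rfl

namespace IsCAR
include h

theorem mul_cc (p q : Fin 2 × n) : e p * e q = -(e q * e p) :=
  eq_neg_of_add_eq_zero_left (h.cc p q)

theorem mul_dd (p q : Fin 2 × n) : f p * f q = -(f q * f p) :=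
  eq_neg_of_add_eq_zero_left (h.dd p q)

theorem chargedQuant_up_sub (j k : n) :
    chargedQuant e f (blockUp (single j k 1 - single k j 1)) =
      e (0, j) * e (0, k) + e (1, j) * e (1, k) := by
  rw [blockUp_sub, map_sub, chargedQuant_up, chargedQuant_up, h.mul_cc (0, k) (0, j),
    h.mul_cc (1, k) (1, j), h.mul_cc (1, k) (0, j), h.mul_cc (0, k) (1, j)]
  module

theorem chargedQuant_low_sub (j k : n) :
    chargedQuant e f (blockLow (single j k 1 - single k j 1)) =
      f (0, j) * f (0, k) + f (1, j) * f (1, k) := by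
  rw [blockLow_sub, map_sub, chargedQuant_low, chargedQuant_low, h.mul_dd (0, k) (0, j),
    h.mul_dd (1, k) (1, j), h.mul_dd (1, k) (0, j), h.mul_dd (0, k) (1, j)]
  module

theorem sq_c (p : Fin 2 × n) : e p * e p = 0 := by
  have h1 : (2 : ℂ) • (e p * e p) = 0 := by rw [two_smul]; exact h.cc p p
  simpa using h1

theorem sq_d (p : Fin 2 × n) : f p * f p = 0 := by
  have h1 : (2 : ℂ) • (f p * f p) = 0 := by rw [two_smul]; exact h.dd p p
  simpa using h1

theorem chargedQuant_up_diag (j : n) :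
    chargedQuant e f (blockUp (single j j Complex.I)) = e (0, j) * e (1, j) := by
  rw [chargedQuant_up, h.sq_c, h.sq_c, h.mul_cc (1, j) (0, j), add_zero, smul_zero, zero_add,
    smul_smul, ← neg_add', ← two_smul ℂ, ← neg_smul, smul_smul]
  -- The entry i of the matrix is chosen to cancel the factor -i left by the mixed term.
  rw [show Complex.I * (Complex.I / 2) * -2 = 1 by linear_combination -Complex.I_sq, one_smul]

theorem chargedQuant_low_diag (j : n) :
    chargedQuant e f (blockLow (single j j (-Complex.I))) = f (1, j) * f (0, j) := by
  rw [chargedQuant_low, h.sq_d, h.sq_d, h.mul_dd (0, j) (1, j), add_zero, smul_zero, zero_add,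
    smul_smul, sub_neg_eq_add, ← two_smul ℂ, smul_smul]
  rw [show -Complex.I * (Complex.I / 2) * 2 = 1 by linear_combination -Complex.I_sq, one_smul]

theorem chargedQuant_lie (X Y : Matrix (n ⊕ n) (n ⊕ n) ℂ) :
    chargedQuant e f ⁅X, Y⁆ = ⁅chargedQuant e f X, chargedQuant e f Y⁆ :=
  h.charged.secondQuant_lie X Y

theorem chargedQuant_injective [Nontrivial A] : Function.Injective (chargedQuant e f) :=
  h.charged.secondQuant_injective

end IsCAR

end ChargedGenerators

/-! ### The representation on complex forms and the isomorphism with su(s + 1, s + 1) -/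

section SpinRepresentation

open Matrix

variable {V : Type*} [NormedAddCommGroup V] [InnerProductSpace ℝ V] [FiniteDimensional ℝ V]
  {s : ℕ}

/-- The complexification of operators, as a homomorphism of real Lie algebras. -/
def baseChangeLie (V : Type*) [NormedAddCommGroup V] [InnerProductSpace ℝ V] :
    Module.End ℝ (Ext V) →ₗ⁅ℝ⁆ Module.End ℂ (ExtC V) :=
  (Module.End.baseChangeHom ℝ ℂ (Ext V)).toLieHom

theorem baseChangeLie_injective : Function.Injective (baseChangeLie V) :=
  LinearMap.baseChangeHom_injective ℝ (Ext V) ℂ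

theorem baseChangeLie_mul (φ ψ : Module.End ℝ (Ext V)) :
    baseChangeLie V (φ * ψ) = baseChangeLie V φ * baseChangeLie V ψ :=
  map_mul (Module.End.baseChangeHom ℝ ℂ (Ext V)) φ ψ

theorem baseChangeLie_one : baseChangeLie V 1 = 1 :=
  map_one (Module.End.baseChangeHom ℝ ℂ (Ext V))

/-- The wedge products with the vectors of a basis, on complex forms. -/
def wedgeC (v : OrthonormalBasis (Fin 2 × Fin (s + 1)) ℝ V) (p : Fin 2 × Fin (s + 1)) :
    Module.End ℂ (ExtC V) := baseChangeLie V (wedge (v p))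

/-- The contractions with the vectors of a basis, on complex forms. -/
def ctrC (v : OrthonormalBasis (Fin 2 × Fin (s + 1)) ℝ V) (p : Fin 2 × Fin (s + 1)) :
    Module.End ℂ (ExtC V) := baseChangeLie V (ctr (v p))

theorem isCAR_wedgeC_ctrC (v : OrthonormalBasis (Fin 2 × Fin (s + 1)) ℝ V) :
    IsCAR (wedgeC v) (ctrC v) := by
  constructor
  · intro a b
    rw [anticomm, wedgeC, wedgeC, ← baseChangeLie_mul, ← baseChangeLie_mul, ← map_add,
      wedge_mul_wedge, neg_add_cancel, map_zero]
  · intro a b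
    rw [anticomm, ctrC, ctrC, ← baseChangeLie_mul, ← baseChangeLie_mul, ← map_add,
      ctr_mul_ctr, neg_add_cancel, map_zero]
  · intro a b
    rw [anticomm, ctrC, wedgeC, ← baseChangeLie_mul, ← baseChangeLie_mul, ← map_add,
      ctr_mul_wedge, sub_add_cancel, map_smul, baseChangeLie_one,
      orthonormal_iff_ite.mp v.orthonormal]
    split_ifs <;> simp

/-- The representation of the split special unitary Lie algebra on complex forms. -/
def spinHom (v : OrthonormalBasis (Fin 2 × Fin (s + 1)) ℝ V) :
    Matrix (Fin (s + 1) ⊕ Fin (s + 1)) (Fin (s + 1) ⊕ Fin (s + 1)) ℂ →ₗ⁅ℝ⁆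
      Module.End ℂ (ExtC V) :=
  { (chargedQuant (wedgeC v) (ctrC v)).restrictScalars ℝ with
    map_lie' := fun {X Y} => (isCAR_wedgeC_ctrC v).chargedQuant_lie X Y }

theorem spinHom_apply (v : OrthonormalBasis (Fin 2 × Fin (s + 1)) ℝ V)
    (X : Matrix (Fin (s + 1) ⊕ Fin (s + 1)) (Fin (s + 1) ⊕ Fin (s + 1)) ℂ) :
    spinHom v X = chargedQuant (wedgeC v) (ctrC v) X := rfl

theorem spinHom_injective (v : OrthonormalBasis (Fin 2 × Fin (s + 1)) ℝ V) :
    Function.Injective (spinHom v) := by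
  have : Nontrivial (Module.End ℂ (ExtC V)) :=
    (baseChangeLie_injective (V := V)).nontrivial
  exact (isCAR_wedgeC_ctrC v).chargedQuant_injective

theorem baseChangeLie_opL (v : OrthonormalBasis (Fin 2 × Fin (s + 1)) ℝ V) (j k : Fin (s + 1)) :
    baseChangeLie V (opL (stdForm v) j k) =
      spinHom v (blockUp (single j k 1 - single k j 1)) := by
  rw [spinHom_apply, (isCAR_wedgeC_ctrC v).chargedQuant_up_sub, opL_stdForm, map_add,
    baseChangeLie_mul, baseChangeLie_mul]
  rfl

theorem baseChangeLie_opLambda (v : OrthonormalBasis (Fin 2 × Fin (s + 1)) ℝ V)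
    (j k : Fin (s + 1)) :
    baseChangeLie V (opLambda (stdForm v) j k) =
      spinHom v (blockLow (single k j 1 - single j k 1)) := by
  rw [spinHom_apply, (isCAR_wedgeC_ctrC v).chargedQuant_low_sub, opLambda_stdForm, map_add,
    baseChangeLie_mul, baseChangeLie_mul]
  rfl

theorem baseChangeLie_opV (v : OrthonormalBasis (Fin 2 × Fin (s + 1)) ℝ V) (j : Fin (s + 1)) :
    baseChangeLie V (opV v j) = spinHom v (blockUp (single j j Complex.I)) := by
  rw [spinHom_apply, (isCAR_wedgeC_ctrC v).chargedQuant_up_diag, opV_eq, baseChangeLie_mul]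
  rfl

theorem baseChangeLie_opA (v : OrthonormalBasis (Fin 2 × Fin (s + 1)) ℝ V) (j : Fin (s + 1)) :
    baseChangeLie V (opA v j) = spinHom v (blockLow (single j j (-Complex.I))) := by
  rw [spinHom_apply, (isCAR_wedgeC_ctrC v).chargedQuant_low_diag, opA_eq, baseChangeLie_mul]
  rfl

theorem image_generators (v : OrthonormalBasis (Fin 2 × Fin (s + 1)) ℝ V) :
    baseChangeLie V '' generators (stdForm v) v = spinHom v '' splitGenerators (Fin (s + 1)) := by
  ext φ
  constructor
  · rintro ⟨ψ, ⟨j, k, hjk, rfl | rfl⟩ | ⟨j, rfl | rfl⟩, rfl⟩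
    · exact ⟨_, Or.inl ⟨j, k, hjk, Or.inl rfl⟩, (baseChangeLie_opL v j k).symm⟩
    · exact ⟨_, Or.inl ⟨j, k, hjk, Or.inr rfl⟩, (baseChangeLie_opLambda v j k).symm⟩
    · exact ⟨_, Or.inr ⟨j, Or.inl rfl⟩, (baseChangeLie_opV v j).symm⟩
    · exact ⟨_, Or.inr ⟨j, Or.inr rfl⟩, (baseChangeLie_opA v j).symm⟩
  · rintro ⟨X, ⟨j, k, hjk, rfl | rfl⟩ | ⟨j, rfl | rfl⟩, rfl⟩
    · exact ⟨_, Or.inl ⟨j, k, hjk, Or.inl rfl⟩, baseChangeLie_opL v j k⟩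
    · exact ⟨_, Or.inl ⟨j, k, hjk, Or.inr rfl⟩, baseChangeLie_opLambda v j k⟩
    · exact ⟨_, Or.inr ⟨j, Or.inl rfl⟩, baseChangeLie_opV v j⟩
    · exact ⟨_, Or.inr ⟨j, Or.inr rfl⟩, baseChangeLie_opA v j⟩

theorem exists_ne_ne (hs : 2 ≤ s) (j k : Fin (s + 1)) : ∃ l, l ≠ j ∧ l ≠ k := by
  have h : ({j, k} : Finset (Fin (s + 1))).card < Fintype.card (Fin (s + 1)) := by
    rw [Fintype.card_fin]
    exact (Finset.card_le_two).trans_lt (by omega)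
  obtain ⟨l, hl⟩ := Finset.exists_mem_notMem_of_card_lt_card (t := Finset.univ) h
  exact ⟨l, by simpa using hl⟩

/-- The real operators and the matrices both embed in the complex operators, where their generating
sets coincide; hence so do the algebras they generate. -/
theorem map_realAlgebra (hs : 2 ≤ s) (v : OrthonormalBasis (Fin 2 × Fin (s + 1)) ℝ V) :
    (realAlgebra (stdForm v) v).map (baseChangeLie V) =
      (splitSU (Fin (s + 1))).map (spinHom v) := by
  rw [realAlgebra, LieSubalgebra.map_lieSpan, image_generators, ← LieSubalgebra.map_lieSpan,
    lieSpan_splitGenerators (exists_ne_ne hs)]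

/-- The real Lie algebra of operators generated by `L_{jk}`, `V_j`, `Λ_{jk}` and `A_j` is
isomorphic to `su(s + 1, s + 1)`. -/
theorem nonempty_realAlgebra_equiv_su (hs : 2 ≤ s)
    (v : OrthonormalBasis (Fin 2 × Fin (s + 1)) ℝ V) :
    Nonempty (realAlgebra (stdForm v) v ≃ₗ⁅ℝ⁆ su (s + 1) (s + 1)) :=
  ⟨((realAlgebra (stdForm v) v).equivMapOfInjective (baseChangeLie V)
      baseChangeLie_injective).trans <|
    (LieEquiv.ofEq _ _ (by rw [map_realAlgebra hs])).trans <|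
    ((splitSU (Fin (s + 1))).equivMapOfInjective (spinHom v) (spinHom_injective v)).symm.trans <|
    (LieEquiv.ofEq _ _ (by rw [map_cayley_su])).trans
    ((su (s + 1) (s + 1)).equivMapOfInjective (cayley (s + 1)) cayley_injective).symm⟩

end SpinRepresentation

/-! ### The wedge pairing and Poincaré duality -/

section Pairing

open CliffordAlgebra (involute)

variable {V : Type*} [NormedAddCommGroup V] [InnerProductSpace ℝ V] [FiniteDimensional ℝ V]
  {s : ℕ}

theorem eq_zero_of_mem_of_lt {k : ℕ} {x : Ext V} (hx : x ∈ ⋀[ℝ]^k V)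
    (hk : Module.finrank ℝ V < k) : x = 0 :=
  congrArg Subtype.val ((component_of_mem hx).symm.trans (component_eq_zero_of_lt V hk x))

theorem mul_mem_exteriorPower {k l : ℕ} {x y : Ext V} (hx : x ∈ ⋀[ℝ]^k V) (hy : y ∈ ⋀[ℝ]^l V) :
    x * y ∈ ⋀[ℝ]^(k + l) V :=
  SetLike.mul_mem_graded (A := fun n : ℕ => ⋀[ℝ]^n V) hx hy

theorem ι_mem_exteriorPower (u : V) : ExteriorAlgebra.ι ℝ u ∈ ⋀[ℝ]^1 V := by
  rw [ExteriorAlgebra.exteriorPower, pow_one]; exact LinearMap.mem_range_self _ u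

theorem wedge_mem (u : V) {k : ℕ} {x : Ext V} (hx : x ∈ ⋀[ℝ]^k V) : wedge u x ∈ ⋀[ℝ]^(k + 1) V := by
  rw [add_comm]; exact mul_mem_exteriorPower (ι_mem_exteriorPower u) hx

theorem ctr_mem_sub_one (u : V) {k : ℕ} {x : Ext V} (hx : x ∈ ⋀[ℝ]^k V) :
    ctr u x ∈ ⋀[ℝ]^(k - 1) V := by
  rcases k with _ | k
  · rw [ctr_mem_zero u hx]; exact zero_mem _
  · exact ctr_mem u hx

/-- The contraction is an antiderivation. -/
theorem ctr_mul (u : V) (x y : Ext V) : ctr u (x * y) = ctr u x * y + involute x * ctr u y := by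
  induction x using CliffordAlgebra.left_induction with
  | algebraMap r =>
    have : ctr u (algebraMap ℝ (Ext V) r) = 0 :=
      CliffordAlgebra.contractLeft_algebraMap _ (innerₗ V u) r
    rw [this, AlgHom.commutes, zero_mul, zero_add, ← Algebra.smul_def, map_smul, Algebra.smul_def]
  | add a b ha hb => simp only [add_mul, map_add, ha, hb]; abel
  | ι_mul x a hx =>
    rw [mul_assoc, ctr_ι_mul, hx, ctr_ι_mul, map_mul, CliffordAlgebra.involute_ι]
    simp only [sub_mul, smul_mul_assoc, mul_add, mul_assoc, neg_mul]
    abel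

theorem involute_ctr (u : V) (x : Ext V) : involute (ctr u x) = -ctr u (involute x) := by
  induction x using CliffordAlgebra.left_induction with
  | algebraMap r =>
    have : ctr u (algebraMap ℝ (Ext V) r) = 0 :=
      CliffordAlgebra.contractLeft_algebraMap _ (innerₗ V u) r
    rw [AlgHom.commutes, this, map_zero, neg_zero]
  | add a b ha hb => simp only [map_add, ha, hb]; abel
  | ι_mul x a hx =>
    rw [ctr_ι_mul, map_sub, map_smul, map_mul, hx, map_mul, CliffordAlgebra.involute_ι, neg_mul,
      neg_mul, map_neg, ctr_ι_mul]
    simp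

theorem ι_mul_ι_mul_comm (u w : V) (x : Ext V) :
    ExteriorAlgebra.ι ℝ u * ExteriorAlgebra.ι ℝ w * x =
      x * (ExteriorAlgebra.ι ℝ u * ExteriorAlgebra.ι ℝ w) := by
  induction x using CliffordAlgebra.left_induction with
  | algebraMap r => exact (Algebra.commutes r _).symm
  | add a b ha hb => rw [mul_add, add_mul, ha, hb]
  | ι_mul x a hx =>
    have h1 := eq_neg_of_add_eq_zero_left (ExteriorAlgebra.ι_add_mul_swap (R := ℝ) w a)
    have h2 := eq_neg_of_add_eq_zero_left (ExteriorAlgebra.ι_add_mul_swap (R := ℝ) u a)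
    have h3 : ExteriorAlgebra.ι ℝ u * ExteriorAlgebra.ι ℝ w * ExteriorAlgebra.ι ℝ a =
        ExteriorAlgebra.ι ℝ a * (ExteriorAlgebra.ι ℝ u * ExteriorAlgebra.ι ℝ w) := by
      rw [mul_assoc, h1, mul_neg, ← mul_assoc, h2, neg_mul, neg_neg, mul_assoc]
    change _ * (ExteriorAlgebra.ι ℝ a * x) = ExteriorAlgebra.ι ℝ a * x * _
    rw [← mul_assoc, h3, mul_assoc, hx, ← mul_assoc]

variable (v : OrthonormalBasis (Fin 2 × Fin (s + 1)) ℝ V)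

/-- The volume form, as a real form. -/
def realVolume : Ext V :=
  (List.ofFn fun j : Fin (s + 1) =>
    ExteriorAlgebra.ι ℝ (v (0, j)) * ExteriorAlgebra.ι ℝ (v (1, j))).prod

include v in
theorem finrank_eq_two_mul : Module.finrank ℝ V = 2 * (s + 1) := by
  rw [Module.finrank_eq_card_basis v.toBasis]
  simp

theorem realVolume_mem : realVolume v ∈ ⋀[ℝ]^(Module.finrank ℝ V) V := by
  have h := SetLike.list_prod_ofFn_mem_graded (A := fun n : ℕ => ⋀[ℝ]^n V)
    (fun _ : Fin (s + 1) => 2)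
    (fun j : Fin (s + 1) => ExteriorAlgebra.ι ℝ (v (0, j)) * ExteriorAlgebra.ι ℝ (v (1, j)))
    (fun j => mul_mem_exteriorPower (ι_mem_exteriorPower _) (ι_mem_exteriorPower _))
  have h2 : (List.ofFn fun _ : Fin (s + 1) => 2).sum = Module.finrank ℝ V := by
    rw [finrank_eq_two_mul v, List.sum_ofFn]; simp [mul_comm]
  rwa [h2] at h

/-- The two claims are proved together: contracting with both covectors of the first pair strips
that pair because these contractions annihilate the rest of the product. -/
theorem prod_pairs_ne_zero (l : List (Fin (s + 1))) (hl : l.Nodup) :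
    (l.map fun j => ExteriorAlgebra.ι ℝ (v (0, j)) * ExteriorAlgebra.ι ℝ (v (1, j))).prod ≠ 0 ∧
    ∀ i k, k ∉ l → ctr (v (i, k)) (l.map fun j =>
      ExteriorAlgebra.ι ℝ (v (0, j)) * ExteriorAlgebra.ι ℝ (v (1, j))).prod = 0 := by
  have hv := orthonormal_iff_ite.mp v.orthonormal
  induction l with
  | nil => exact ⟨by simp, fun i k _ => by simpa using ctr_one _⟩
  | cons j l ih =>
    rw [List.nodup_cons] at hl
    obtain ⟨h1, h2⟩ := ih hl.2
    rw [List.map_cons, List.prod_cons]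
    refine ⟨fun h0 => h1 ?_, fun i k hk => ?_⟩
    · have := congrArg (fun x => ctr (v (1, j)) (ctr (v (0, j)) x)) h0
      simpa [mul_assoc, ctr_ι_mul, hv, h2 _ j hl.1] using this
    · rw [List.mem_cons, not_or] at hk
      rw [mul_assoc, ctr_ι_mul, ctr_ι_mul, h2 i k hk.2, hv, hv]
      simp [hk.1]

theorem realVolume_ne_zero : realVolume v ≠ 0 := by
  rw [realVolume, List.ofFn_eq_map]
  exact (prod_pairs_ne_zero v _ (List.nodup_finRange _)).1

/-- The coefficient of the volume form. -/
def topCoeff : Ext V →ₗ[ℝ] ℝ := (metric V).flip (realVolume v)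

theorem topCoeff_apply (x : Ext V) : topCoeff v x = metric V x (realVolume v) := rfl

theorem topCoeff_of_mem_ne {k : ℕ} {x : Ext V} (hx : x ∈ ⋀[ℝ]^k V)
    (hk : k ≠ Module.finrank ℝ V) : topCoeff v x = 0 :=
  metric_eq_zero_of_mem hx (realVolume_mem v) hk

/-- The adjoint of the contraction raises the degree of the volume form beyond the top. With the
antiderivation rule this yields integration by parts. -/
theorem topCoeff_ctr (u : V) (x : Ext V) : topCoeff v (ctr u x) = 0 := by
  rw [topCoeff_apply, metric_comm, ← metric_wedge,
    eq_zero_of_mem_of_lt (wedge_mem u (realVolume_mem v)) (Nat.lt_succ_self _), map_zero]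
  rfl

theorem topCoeff_ctr_mul (u : V) (x y : Ext V) :
    topCoeff v (ctr u x * y) = -topCoeff v (involute x * ctr u y) := by
  have := topCoeff_ctr v u (x * y)
  rw [ctr_mul, map_add] at this
  linarith

/-- Two integrations by parts: their signs, the sign of the grading involution and the
anticommutation of the contractions cancel. -/
theorem topCoeff_ctr_ctr_mul (u w : V) (x y : Ext V) :
    topCoeff v (ctr u (ctr w x) * y) = topCoeff v (x * ctr u (ctr w y)) := by
  rw [topCoeff_ctr_mul, involute_ctr, neg_mul, map_neg, neg_neg, topCoeff_ctr_mul,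
    CliffordAlgebra.involute_involute]
  have : ctr w (ctr u y) = -ctr u (ctr w y) := CliffordAlgebra.contractLeft_comm _ _ y
  rw [this, mul_neg, map_neg, neg_neg]

theorem realVolume_mul (x : Ext V) :
    realVolume v * x = ExteriorAlgebra.algebraMapInv x • realVolume v := by
  suffices h : LinearMap.mulLeft ℝ (realVolume v) =
      (ExteriorAlgebra.algebraMapInv.toLinearMap : Ext V →ₗ[ℝ] ℝ).smulRight (realVolume v) from
    congrArg (fun f : Module.End ℝ (Ext V) => f x) h
  refine ext_ιMulti fun n a => ?_
  rcases n with _ | n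
  · simp
  · simp only [LinearMap.mulLeft_apply, LinearMap.smulRight_apply, AlgHom.toLinearMap_apply]
    rw [eq_zero_of_mem_of_lt (mul_mem_exteriorPower (realVolume_mem v) (ιMulti_mem (n + 1) a))
      (by omega), ExteriorAlgebra.ιMulti_succ_apply, map_mul]
    simp [ExteriorAlgebra.algebraMapInv]

theorem metric_one (x : Ext V) : metric V 1 x = ExteriorAlgebra.algebraMapInv x := by
  suffices h : metric V 1 = (ExteriorAlgebra.algebraMapInv.toLinearMap : Ext V →ₗ[ℝ] ℝ) from
    congrArg (fun f : Ext V →ₗ[ℝ] ℝ => f x) h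
  refine ext_ιMulti fun n a => ?_
  rw [← ExteriorAlgebra.ιMulti_zero_apply (R := ℝ) (M := V) Fin.elim0]
  rcases n with _ | n
  · rw [metric_ιMulti]; simp
  · rw [metric_eq_zero_of_mem (ιMulti_mem _ _) (ιMulti_mem _ _) (by omega),
      AlgHom.toLinearMap_apply, ExteriorAlgebra.ιMulti_succ_apply, map_mul]
    simp [ExteriorAlgebra.algebraMapInv]

/-- Poincaré duality: the wedge pairing is nondegenerate. -/
theorem eq_zero_of_topCoeff_mul {x : Ext V} (hx : ∀ y, topCoeff v (y * x) = 0) : x = 0 := by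
  -- The annihilator of the pairing is stable under contractions. Pairing with the volume form kills
  -- its degree zero part, and the adjunction of wedge and contraction carries this to every degree.
  have hctr : ∀ x : Ext V, (∀ y, topCoeff v (y * x) = 0) →
      ∀ u y, topCoeff v (y * ctr u x) = 0 := by
    intro x hx u y
    have h := topCoeff_ctr_mul v u (involute y) x
    rw [hx, CliffordAlgebra.involute_involute] at h
    linarith
  have hone : ∀ x : Ext V, (∀ y, topCoeff v (y * x) = 0) → metric V 1 x = 0 := by
    intro x hx
    have h := hx (realVolume v)
    rw [realVolume_mul, map_smul, smul_eq_mul] at h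
    rw [metric_one]
    exact (mul_eq_zero.mp h).resolve_right
      fun h0 => realVolume_ne_zero v (metric_self_eq_zero V h0)
  have hmulti : ∀ n (a : Fin n → V) (x : Ext V), (∀ y, topCoeff v (y * x) = 0) →
      metric V (ExteriorAlgebra.ιMulti ℝ n a) x = 0 := by
    intro n
    induction n with
    | zero => intro a x hx; rw [ExteriorAlgebra.ιMulti_zero_apply]; exact hone x hx
    | succ n ih =>
      intro a x hx
      rw [ExteriorAlgebra.ιMulti_succ_apply, ← wedge_apply, metric_wedge]
      exact ih _ _ (hctr x hx _)
  refine (metric_nondegenerate V).2 x fun z => ?_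
  have : (metric V).flip x = 0 := ext_ιMulti fun n a => hmulti n a x hx
  exact congrArg (fun f : Ext V →ₗ[ℝ] ℝ => f z) this

end Pairing

/-! ### The modified form and the real form of the complexified algebra -/

section ModifiedForm

variable {V : Type*} [NormedAddCommGroup V] [InnerProductSpace ℝ V] [FiniteDimensional ℝ V]
  {s : ℕ} (v : OrthonormalBasis (Fin 2 × Fin (s + 1)) ℝ V)

theorem conj_tmul (c : ℂ) (x : Ext V) :
    conj (c ⊗ₜ[ℝ] x : ExtC V) = (starRingEnd ℂ c) ⊗ₜ[ℝ] x := rfl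

theorem herm_volumeForm_tmul (c : ℂ) (x : Ext V) :
    herm (c ⊗ₜ[ℝ] x : ExtC V) (volumeForm v) = c * topCoeff v x := by
  change (metric V).baseChange ℂ (c ⊗ₜ[ℝ] x) (conj ((1 : ℂ) ⊗ₜ[ℝ] realVolume v)) = _
  rw [conj_tmul, LinearMap.BilinForm.baseChange_tmul, map_one, mul_one, topCoeff_apply,
    Complex.real_smul, mul_comm]

theorem herm_add_left (α α' β : ExtC V) : herm (α + α') β = herm α β + herm α' β := by
  simp [herm]

theorem modifiedForm_add_left (α α' β : ExtC V) :
    modifiedForm v (α + α') β = modifiedForm v α β + modifiedForm v α' β := by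
  simp only [modifiedForm, form, map_add, add_mul, herm_add_left, mul_add, Finset.sum_add_distrib]

theorem modifiedForm_add_right (α β β' : ExtC V) :
    modifiedForm v α (β + β') = modifiedForm v α β + modifiedForm v α β' := by
  simp only [modifiedForm, form, map_add, herm_add_left, mul_add, Finset.sum_add_distrib]

theorem componentC_tmul (k : ℕ) (c : ℂ) (x : Ext V) :
    componentC k (c ⊗ₜ[ℝ] x : ExtC V) = c ⊗ₜ[ℝ] (component V k x : Ext V) := rfl

theorem modifiedForm_tmul (c d : ℂ) (x y : Ext V) :
    modifiedForm v (c ⊗ₜ[ℝ] x) (d ⊗ₜ[ℝ] y) =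
      c * starRingEnd ℂ d * modifiedForm v ((1 : ℂ) ⊗ₜ[ℝ] x) ((1 : ℂ) ⊗ₜ[ℝ] y) := by
  simp only [modifiedForm, form, componentC_tmul, conj_tmul, Algebra.TensorProduct.tmul_mul_tmul,
    herm_volumeForm_tmul, Finset.mul_sum, map_one, mul_one, one_mul]
  refine Finset.sum_congr rfl fun _ _ => Finset.sum_congr rfl fun _ _ =>
    Finset.sum_congr rfl fun _ _ => by ring

/-- The modified form on real forms. -/
def realForm : Ext V →ₗ[ℝ] Ext V →ₗ[ℝ] ℂ :=
  LinearMap.mk₂ ℝ (fun x y => modifiedForm v ((1 : ℂ) ⊗ₜ[ℝ] x) ((1 : ℂ) ⊗ₜ[ℝ] y))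
    (fun x x' y => by rw [TensorProduct.tmul_add, modifiedForm_add_left])
    (fun r x y => by
      rw [← TensorProduct.smul_tmul, modifiedForm_tmul, map_one, mul_one, Complex.real_smul,
        Complex.real_smul, mul_one])
    (fun x y y' => by rw [TensorProduct.tmul_add, modifiedForm_add_right])
    (fun r x y => by
      rw [← TensorProduct.smul_tmul, modifiedForm_tmul, one_mul, Complex.real_smul,
        Complex.real_smul, mul_one, Complex.conj_ofReal])

theorem modifiedForm_tmul_eq (c d : ℂ) (x y : Ext V) :
    modifiedForm v (c ⊗ₜ[ℝ] x) (d ⊗ₜ[ℝ] y) = c * starRingEnd ℂ d * realForm v x y :=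
  modifiedForm_tmul v c d x y

theorem realForm_of_mem {a b : ℕ} {x y : Ext V} (hx : x ∈ ⋀[ℝ]^a V) (hy : y ∈ ⋀[ℝ]^b V) :
    realForm v x y = Complex.I ^ (s + 1 + b + a * b) * topCoeff v (x * y) := by
  by_cases ha : Module.finrank ℝ V < a
  · rw [eq_zero_of_mem_of_lt hx ha]; simp
  by_cases hb : Module.finrank ℝ V < b
  · rw [eq_zero_of_mem_of_lt hy hb]; simp
  have ha' : a ∈ Finset.range (Module.finrank ℝ V + 1) := by simp; omega
  have hb' : b ∈ Finset.range (Module.finrank ℝ V + 1) := by simp; omega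
  change modifiedForm v ((1 : ℂ) ⊗ₜ[ℝ] x) ((1 : ℂ) ⊗ₜ[ℝ] y) = _
  simp only [modifiedForm, form, componentC_tmul, conj_tmul, Algebra.TensorProduct.tmul_mul_tmul,
    herm_volumeForm_tmul, map_one, mul_one, one_mul]
  rw [Finset.sum_eq_single_of_mem b hb', Finset.sum_eq_single_of_mem a ha',
    Finset.sum_eq_single_of_mem b hb']
  · rw [component_of_mem hy, component_of_mem hy, component_of_mem hx, pow_add _ (s + 1 + b), mul_assoc]
  · intro l _ hl
    rw [component_of_mem hy, component_of_mem_ne hy hl.symm]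
    simp
  · intro l _ hl
    rw [component_of_mem_ne hx hl.symm]
    simp
  · intro l _ hl
    rw [component_of_mem_ne hy hl.symm]
    simp

/-- A property of forms that is additive holds if it holds for homogeneous forms. -/
theorem homogeneous_induction {P : Ext V → Prop} (zero : P 0)
    (add : ∀ x y, P x → P y → P (x + y)) (mem : ∀ k, ∀ x ∈ ⋀[ℝ]^k V, P x) (x : Ext V) : P x := by
  induction x using DirectSum.Decomposition.inductionOn fun i => ⋀[ℝ]^i V with
  | zero => exact zero
  | add x y hx hy => exact add x y hx hy
  | homogeneous hx => exact mem _ _ hx.2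

/-- The real operators that preserve the modified form. -/
def preserving : LieSubalgebra ℝ (Module.End ℝ (Ext V)) where
  carrier := {ψ | ∀ x y, realForm v (ψ x) y + realForm v x (ψ y) = 0}
  add_mem' := by
    intro φ ψ hφ hψ x y
    simp only [LinearMap.add_apply, map_add]
    linear_combination hφ x y + hψ x y
  zero_mem' := by intro x y; simp
  smul_mem' := by
    intro r φ hφ x y
    simp only [LinearMap.smul_apply, map_smul, ← smul_add]
    rw [hφ x y, smul_zero]
  lie_mem' := by
    intro φ ψ hφ hψ x y
    simp only [Ring.lie_def, LinearMap.sub_apply, Module.End.mul_apply, map_sub]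
    linear_combination hφ (ψ x) y - hψ (φ x) y + hφ x (ψ y) - hψ x (φ y)

theorem mem_preserving_of_homogeneous {ψ : Module.End ℝ (Ext V)}
    (h : ∀ a b, ∀ x ∈ ⋀[ℝ]^a V, ∀ y ∈ ⋀[ℝ]^b V,
      realForm v (ψ x) y + realForm v x (ψ y) = 0) : ψ ∈ preserving v := by
  intro x y
  induction x using homogeneous_induction with
  | zero => simp
  | add x x' hx hx' => simp only [map_add, LinearMap.add_apply]; linear_combination hx + hx'
  | mem a x hx =>
    induction y using homogeneous_induction with
    | zero => simp
    | add y y' hy hy' => simp only [map_add]; linear_combination hy + hy'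
    | mem b y hy => exact h a b x hx y hy

theorem I_pow_cancel {p q : ℕ} (h : p % 4 = (q + 2) % 4) :
    Complex.I ^ p + Complex.I ^ q = 0 := by
  rw [Complex.I_pow_eq_pow_mod p, h, ← Complex.I_pow_eq_pow_mod, pow_add, Complex.I_sq]
  ring

theorem wedge_mul_wedge_mem_preserving (u w : V) : wedge u * wedge w ∈ preserving v := by
  refine mem_preserving_of_homogeneous v fun a b x hx y hy => ?_
  have hux : (wedge u * wedge w) x ∈ ⋀[ℝ]^(a + 1 + 1) V := wedge_mem u (wedge_mem w hx)
  have huy : (wedge u * wedge w) y ∈ ⋀[ℝ]^(b + 1 + 1) V := wedge_mem u (wedge_mem w hy)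
  have ht : x * (wedge u * wedge w) y = (wedge u * wedge w) x * y := by
    simp only [Module.End.mul_apply, wedge_apply, ← mul_assoc]
    rw [ι_mul_ι_mul_comm, mul_assoc x]
  rw [realForm_of_mem v hux hy, realForm_of_mem v hx huy, ht, ← add_mul]
  by_cases hab : a + 1 + 1 + b = Module.finrank ℝ V
  · rw [finrank_eq_two_mul v] at hab
    -- The exponents of i differ by 2(b - a) - 2. As a + b + 2 = 2(s + 1), the difference b - a is
    -- even, so the two powers are opposite.
    rw [I_pow_cancel, zero_mul]
    have h1 : (a + 1 + 1) * b = a * b + 2 * b := by ring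
    have h2 : a * (b + 1 + 1) = a * b + 2 * a := by ring
    rw [h1, h2]
    omega
  · rw [topCoeff_of_mem_ne v (mul_mem_exteriorPower hux hy) hab, Complex.ofReal_zero, mul_zero]

theorem ctr_mul_ctr_mem_preserving (u w : V) : ctr u * ctr w ∈ preserving v := by
  refine mem_preserving_of_homogeneous v fun a b x hx y hy => ?_
  have hux : (ctr u * ctr w) x ∈ ⋀[ℝ]^(a - 1 - 1) V := ctr_mem_sub_one u (ctr_mem_sub_one w hx)
  have huy : (ctr u * ctr w) y ∈ ⋀[ℝ]^(b - 1 - 1) V := ctr_mem_sub_one u (ctr_mem_sub_one w hy)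
  have ht : topCoeff v (x * (ctr u * ctr w) y) = topCoeff v ((ctr u * ctr w) x * y) :=
    (topCoeff_ctr_ctr_mul v u w x y).symm
  rw [realForm_of_mem v hux hy, realForm_of_mem v hx huy, ht, ← add_mul]
  by_cases hab : a - 1 - 1 + b = Module.finrank ℝ V
  · by_cases hab' : a + (b - 1 - 1) = Module.finrank ℝ V
    · rw [finrank_eq_two_mul v] at hab hab'
      rw [I_pow_cancel, zero_mul]
      obtain ⟨a, rfl⟩ : ∃ c, a = c + 2 := ⟨a - 2, by omega⟩
      obtain ⟨b, rfl⟩ : ∃ c, b = c + 2 := ⟨b - 2, by omega⟩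
      simp only [Nat.add_sub_cancel, Nat.reduceSubDiff] at *
      have h1 : a * (b + 2) = a * b + 2 * a := by ring
      have h2 : (a + 2) * b = a * b + 2 * b := by ring
      rw [h1, h2]
      omega
    · rw [← ht, topCoeff_of_mem_ne v (mul_mem_exteriorPower hx huy) hab', Complex.ofReal_zero,
        mul_zero]
  · rw [topCoeff_of_mem_ne v (mul_mem_exteriorPower hux hy) hab, Complex.ofReal_zero, mul_zero]

theorem realAlgebra_le_preserving : realAlgebra (stdForm v) v ≤ preserving v := by
  refine LieSubalgebra.lieSpan_le.mpr ?_
  rintro ψ (⟨j, k, -, rfl | rfl⟩ | ⟨j, rfl | rfl⟩)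
  · rw [opL_stdForm]
    exact add_mem (wedge_mul_wedge_mem_preserving v _ _) (wedge_mul_wedge_mem_preserving v _ _)
  · rw [opLambda_stdForm]
    exact add_mem (ctr_mul_ctr_mem_preserving v _ _) (ctr_mul_ctr_mem_preserving v _ _)
  · rw [opV_eq]
    exact wedge_mul_wedge_mem_preserving v _ _
  · rw [opA_eq]
    exact ctr_mul_ctr_mem_preserving v _ _

/-- Only the part of `y` of complementary degree contributes, so for fixed `a` the form is the wedge
pairing times a constant power of i, and inherits its nondegeneracy. -/
theorem realForm_eq_topCoeff {a : ℕ} {x : Ext V} (hx : x ∈ ⋀[ℝ]^a V)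
    (ha : a ≤ Module.finrank ℝ V) (y : Ext V) :
    realForm v x y = Complex.I ^ (s + 1 + (Module.finrank ℝ V - a) +
      a * (Module.finrank ℝ V - a)) * topCoeff v (x * y) := by
  induction y using homogeneous_induction with
  | zero => simp
  | add y y' hy hy' => rw [map_add, hy, hy', mul_add, map_add]; push_cast; ring
  | mem b y hy =>
    by_cases hb : b = Module.finrank ℝ V - a
    · rw [realForm_of_mem v hx hy, hb]
    · rw [realForm_of_mem v hx hy, topCoeff_of_mem_ne v (mul_mem_exteriorPower hx hy) (by omega)]
      simp

theorem eq_zero_of_realForm {y : Ext V} (hy : ∀ x, realForm v x y = 0) : y = 0 := by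
  refine eq_zero_of_topCoeff_mul v fun x => ?_
  induction x using homogeneous_induction with
  | zero => simp
  | add x x' hx hx' => rw [add_mul, map_add, hx, hx', add_zero]
  | mem a x hx =>
    by_cases ha : Module.finrank ℝ V < a
    · rw [eq_zero_of_mem_of_lt hx ha]; simp
    · have := hy x
      rw [realForm_eq_topCoeff v hx (by omega)] at this
      simpa using this

theorem preservesModifiedForm_baseChange_iff {ψ : Module.End ℝ (Ext V)} :
    PreservesModifiedForm v (LinearMap.baseChange ℂ ψ) ↔ ψ ∈ preserving v := by
  constructor
  · intro h x y
    have := h ((1 : ℂ) ⊗ₜ[ℝ] x) ((1 : ℂ) ⊗ₜ[ℝ] y)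
    rw [LinearMap.baseChange_tmul, LinearMap.baseChange_tmul, modifiedForm_tmul_eq,
      modifiedForm_tmul_eq] at this
    simpa using this
  · intro h α β
    have hz : ∀ γ : ExtC V, modifiedForm v 0 γ = 0 := fun γ => by
      have := modifiedForm_add_left v 0 0 γ
      rw [add_zero] at this
      exact left_eq_add.mp this
    have hz' : ∀ γ : ExtC V, modifiedForm v γ 0 = 0 := fun γ => by
      have := modifiedForm_add_right v γ 0 0
      rw [add_zero] at this
      exact left_eq_add.mp this
    induction α using TensorProduct.induction_on with
    | zero => rw [map_zero, hz, hz, add_zero]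
    | add α α' hα hα' =>
      rw [map_add, modifiedForm_add_left, modifiedForm_add_left]
      linear_combination hα + hα'
    | tmul c x =>
      induction β using TensorProduct.induction_on with
      | zero => rw [map_zero, hz', hz', add_zero]
      | add β β' hβ hβ' =>
        rw [map_add, modifiedForm_add_right, modifiedForm_add_right]
        linear_combination hβ + hβ'
      | tmul d y =>
        rw [LinearMap.baseChange_tmul, LinearMap.baseChange_tmul, modifiedForm_tmul_eq,
          modifiedForm_tmul_eq, ← mul_add, h x y, mul_zero]

/-- Splitting the complex coefficients of a span into real and imaginary parts moves the real
scalars into `𝔤`. -/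
theorem mem_complexification {𝔤 : LieSubalgebra ℝ (Module.End ℝ (Ext V))}
    {φ : Module.End ℂ (ExtC V)} (hφ : φ ∈ complexification 𝔤) :
    ∃ ψ ∈ 𝔤, ∃ χ ∈ 𝔤, φ = LinearMap.baseChange ℂ ψ + Complex.I • LinearMap.baseChange ℂ χ := by
  change φ ∈ Submodule.span ℂ {φ | ∃ ψ ∈ 𝔤, φ = LinearMap.baseChange ℂ ψ} at hφ
  induction hφ using Submodule.span_induction with
  | zero => exact ⟨0, zero_mem _, 0, zero_mem _, by simp⟩
  | mem φ hφ =>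
    obtain ⟨ψ, hψ, rfl⟩ := hφ
    exact ⟨ψ, hψ, 0, zero_mem _, by simp⟩
  | add φ φ' _ _ h h' =>
    obtain ⟨ψ, hψ, χ, hχ, rfl⟩ := h
    obtain ⟨ψ', hψ', χ', hχ', rfl⟩ := h'
    refine ⟨ψ + ψ', add_mem hψ hψ', χ + χ', add_mem hχ hχ', ?_⟩
    rw [LinearMap.baseChange_add, LinearMap.baseChange_add]
    module
  | smul c φ _ h =>
    obtain ⟨ψ, hψ, χ, hχ, rfl⟩ := h
    refine ⟨c.re • ψ - c.im • χ, sub_mem (𝔤.smul_mem _ hψ) (𝔤.smul_mem _ hχ),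
      c.re • χ + c.im • ψ, add_mem (𝔤.smul_mem _ hχ) (𝔤.smul_mem _ hψ), ?_⟩
    have hre : ∀ (r : ℝ) (θ : Module.End ℝ (Ext V)),
        LinearMap.baseChange ℂ (r • θ) = (r : ℂ) • LinearMap.baseChange ℂ θ := fun r θ => by
      rw [LinearMap.baseChange_smul]; rfl
    rw [LinearMap.baseChange_sub, LinearMap.baseChange_add, hre, hre, hre, hre]
    have hI : ∀ θ : Module.End ℂ (ExtC V),
        -((c.im : ℂ) • θ) = (c.im : ℂ) • Complex.I • Complex.I • θ := fun θ => by
      rw [smul_smul Complex.I, Complex.I_mul_I, neg_one_smul, smul_neg]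
    rw [sub_eq_add_neg, hI]
    conv_lhs => rw [← Complex.re_add_im c]
    module

/-- The real Lie algebra is the set of those elements of its complexification that preserve the
modified form. -/
theorem exists_mem_iff_preserves {𝔤 : LieSubalgebra ℝ (Module.End ℝ (Ext V))}
    (h𝔤 : 𝔤 ≤ preserving v) (φ : Module.End ℂ (ExtC V)) :
    (∃ ψ ∈ 𝔤, φ = LinearMap.baseChange ℂ ψ) ↔
      φ ∈ complexification 𝔤 ∧ PreservesModifiedForm v φ := by
  constructor
  · rintro ⟨ψ, hψ, rfl⟩
    exact ⟨Submodule.subset_span ⟨ψ, hψ, rfl⟩,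
      (preservesModifiedForm_baseChange_iff v).mpr (h𝔤 hψ)⟩
  · rintro ⟨hφ, hp⟩
    obtain ⟨ψ, hψ, χ, hχ, rfl⟩ := mem_complexification hφ
    refine ⟨ψ, hψ, ?_⟩
    suffices χ = 0 by rw [this, LinearMap.baseChange_zero, smul_zero, add_zero]
    refine LinearMap.ext fun y => eq_zero_of_realForm v fun x => ?_
    have h1 := hp ((1 : ℂ) ⊗ₜ[ℝ] x) ((1 : ℂ) ⊗ₜ[ℝ] y)
    simp only [LinearMap.add_apply, LinearMap.smul_apply, LinearMap.baseChange_tmul,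
      TensorProduct.smul_tmul', smul_eq_mul, mul_one, modifiedForm_add_left,
      modifiedForm_add_right, modifiedForm_tmul_eq, map_one, Complex.conj_I, one_mul] at h1
    have h2 := h𝔤 hψ x y
    have h3 := h𝔤 hχ x y
    -- Conjugate linearity in the second slot turns `h1 - h2` into i times the difference of the two
    -- `χ` terms, whereas `h3` says that their sum vanishes.
    have h4 : Complex.I * realForm v x (χ y) = 0 := by
      linear_combination (1 / 2 : ℂ) * (h2 - h1 + Complex.I * h3)
    exact (mul_eq_zero.mp h4).resolve_left Complex.I_ne_zero

end ModifiedForm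

/-! ### Independence of the coframe -/

section AdaptedCoframes

variable {V : Type*} [NormedAddCommGroup V] [InnerProductSpace ℝ V] [FiniteDimensional ℝ V]
  {s : ℕ}

theorem ι_mul_ι_rotation (a b : V) (p q r t : ℝ) :
    ExteriorAlgebra.ι ℝ (p • a + q • b) * ExteriorAlgebra.ι ℝ (r • a + t • b) =
      (p * t - q * r) • (ExteriorAlgebra.ι ℝ a * ExteriorAlgebra.ι ℝ b) := by
  have h := eq_neg_of_add_eq_zero_left (ExteriorAlgebra.ι_add_mul_swap (R := ℝ) b a)
  simp only [map_add, map_smul, add_mul, mul_add, smul_mul_assoc, mul_smul_comm,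
    ExteriorAlgebra.ι_sq_zero, h]
  module

theorem opV_eq_or_eq_neg (v v' : OrthonormalBasis (Fin 2 × Fin (s + 1)) ℝ V) (j : Fin (s + 1))
    (h : ∀ i p, p.2 ≠ j → inner ℝ (v p) (v' (i, j)) = 0) :
    opV v' j = opV v j ∨ opV v' j = -opV v j := by
  have hexp : ∀ i, v' (i, j) =
      (inner ℝ (v (0, j)) (v' (i, j)) : ℝ) • v (0, j) +
        (inner ℝ (v (1, j)) (v' (i, j)) : ℝ) • v (1, j) := by
    intro i
    conv_lhs => rw [← v.sum_repr' (v' (i, j)), Fintype.sum_prod_type]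
    rw [Fin.sum_univ_two, Finset.sum_eq_single j, Finset.sum_eq_single j]
    · intro k _ hk; rw [h i (1, k) hk, zero_smul]
    · simp
    · intro k _ hk; rw [h i (0, k) hk, zero_smul]
    · simp
  set p := (inner ℝ (v (0, j)) (v' (0, j)) : ℝ)
  set q := (inner ℝ (v (1, j)) (v' (0, j)) : ℝ)
  set r := (inner ℝ (v (0, j)) (v' (1, j)) : ℝ)
  set t := (inner ℝ (v (1, j)) (v' (1, j)) : ℝ)
  have hv := orthonormal_iff_ite.mp v.orthonormal
  have hv' := orthonormal_iff_ite.mp v'.orthonormal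
  have h0 : v' (0, j) = p • v (0, j) + q • v (1, j) := hexp 0
  have h1 : v' (1, j) = r • v (0, j) + t • v (1, j) := hexp 1
  have e00 : p * p + q * q = 1 := by
    have := hv' (0, j) (0, j)
    rw [h0] at this
    simpa [inner_add_left, inner_add_right, inner_smul_left, inner_smul_right, hv,
      -inner_self_eq_norm_sq_to_K] using this
  have e11 : r * r + t * t = 1 := by
    have := hv' (1, j) (1, j)
    rw [h1] at this
    simpa [inner_add_left, inner_add_right, inner_smul_left, inner_smul_right, hv,
      -inner_self_eq_norm_sq_to_K] using this
  have e01 : p * r + q * t = 0 := by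
    have := hv' (0, j) (1, j)
    rw [h0, h1] at this
    simpa [inner_add_left, inner_add_right, inner_smul_left, inner_smul_right, hv, mul_comm]
      using this
  -- Lagrange's identity: the squared determinant is (p² + q²)(r² + t²) - (pr + qt)².
  have hdet : (p * t - q * r) * (p * t - q * r) = 1 := by
    linear_combination e11 * (p * p + q * q) + e00 - (p * r + q * t) * e01
  have hop : opV v' j = (p * t - q * r) • opV v j := by
    rw [opV, opV, h0, h1, ι_mul_ι_rotation]
    exact LinearMap.ext fun x => smul_mul_assoc _ _ _
  rw [hop]
  rcases mul_self_eq_one_iff.mp hdet with hd | hd <;> rw [hd]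
  · exact Or.inl (one_smul _ _)
  · exact Or.inr (neg_one_smul _ _)

/-- A change of orientation in a plane W_j only changes the signs of V_j and A_j, which a Lie
subalgebra does not see. -/
theorem realAlgebra_le_of_inner_eq_zero (w : Fin (s + 1) → Fin (s + 1) → Ext V)
    (v v' : OrthonormalBasis (Fin 2 × Fin (s + 1)) ℝ V)
    (h : ∀ i p j, p.2 ≠ j → inner ℝ (v p) (v' (i, j)) = 0) :
    realAlgebra w v' ≤ realAlgebra w v := by
  refine LieSubalgebra.lieSpan_le.mpr ?_
  have hV : ∀ j, opV v j ∈ realAlgebra w v := fun j =>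
    LieSubalgebra.subset_lieSpan (Or.inr ⟨j, Or.inl rfl⟩)
  have hA : ∀ j, opA v j ∈ realAlgebra w v := fun j =>
    LieSubalgebra.subset_lieSpan (Or.inr ⟨j, Or.inr rfl⟩)
  rintro ψ (hψ | ⟨j, rfl | rfl⟩)
  · exact LieSubalgebra.subset_lieSpan (Or.inl hψ)
  · rcases opV_eq_or_eq_neg v v' j fun i p => h i p j with hj | hj <;> rw [hj]
    · exact hV j
    · exact neg_mem (hV j)
  · rw [opA]
    rcases opV_eq_or_eq_neg v v' j fun i p => h i p j with hj | hj <;> rw [hj]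
    · exact hA j
    · rw [adj_neg]; exact neg_mem (hA j)

end AdaptedCoframes

/-! ### Adapted coframes on the manifold -/

section Manifold

variable {E : Type*} [NormedAddCommGroup E] [NormedSpace ℝ E] [FiniteDimensional ℝ E]
  {M : Type*} [TopologicalSpace M] [ChartedSpace E M] [IsManifold 𝓘(ℝ, E) ∞ M]
  [RiemannianBundle (fun p : M => TangentSpace 𝓘(ℝ, E) p)] {s : ℕ} {p : M}

theorem sum_apply_smul_toDual (α : Cotangent E p) :
    ∑ a, α (stdOrthonormalBasis ℝ (TangentSpace 𝓘(ℝ, E) p) a) •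
      InnerProductSpace.toDual ℝ _ (stdOrthonormalBasis ℝ (TangentSpace 𝓘(ℝ, E) p) a) = α := by
  obtain ⟨x, rfl⟩ := (InnerProductSpace.toDual ℝ (TangentSpace 𝓘(ℝ, E) p)).surjective α
  conv_rhs => rw [← (stdOrthonormalBasis ℝ (TangentSpace 𝓘(ℝ, E) p)).sum_repr' x, map_sum]
  refine Finset.sum_congr rfl fun a _ => ?_
  rw [InnerProductSpace.toDual_apply_apply, LinearIsometryEquiv.map_smulₛₗ, real_inner_comm]
  rfl

theorem toExt_eq_stdForm
    {w : Fin (s + 1) → Fin (s + 1) → TangentSpace 𝓘(ℝ, E) p [⋀^Fin 2]→L[ℝ] ℝ}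
    {v : OrthonormalBasis (Fin 2 × Fin (s + 1)) ℝ (Cotangent E p)} (h : IsAdapted w v)
    (j k : Fin (s + 1)) : toExt (w j k) = stdForm v j k := by
  -- Expanding both covectors in the dual basis reassembles their wedge product. The factor 1/2 in
  -- `toExt` then compensates for the two antisymmetric terms, which contribute equally.
  have key : ∀ α β : Cotangent E p,
      ∑ a, ∑ b, (α (stdOrthonormalBasis ℝ (TangentSpace 𝓘(ℝ, E) p) a) *
        β (stdOrthonormalBasis ℝ (TangentSpace 𝓘(ℝ, E) p) b)) •
      (ExteriorAlgebra.ι ℝ (InnerProductSpace.toDual ℝ _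
          (stdOrthonormalBasis ℝ (TangentSpace 𝓘(ℝ, E) p) a)) *
        ExteriorAlgebra.ι ℝ (InnerProductSpace.toDual ℝ _
          (stdOrthonormalBasis ℝ (TangentSpace 𝓘(ℝ, E) p) b))) =
      (ExteriorAlgebra.ι ℝ α * ExteriorAlgebra.ι ℝ β : Ext (Cotangent E p)) := by
    intro α β
    conv_rhs => rw [← sum_apply_smul_toDual α, ← sum_apply_smul_toDual β]
    simp only [map_sum, map_smul, Finset.sum_mul_sum, smul_mul_smul_comm]
  have key' : ∀ α β : Cotangent E p,
      ∑ a, ∑ b, (α (stdOrthonormalBasis ℝ (TangentSpace 𝓘(ℝ, E) p) b) *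
        β (stdOrthonormalBasis ℝ (TangentSpace 𝓘(ℝ, E) p) a)) •
      (ExteriorAlgebra.ι ℝ (InnerProductSpace.toDual ℝ _
          (stdOrthonormalBasis ℝ (TangentSpace 𝓘(ℝ, E) p) a)) *
        ExteriorAlgebra.ι ℝ (InnerProductSpace.toDual ℝ _
          (stdOrthonormalBasis ℝ (TangentSpace 𝓘(ℝ, E) p) b))) =
      (ExteriorAlgebra.ι ℝ β * ExteriorAlgebra.ι ℝ α : Ext (Cotangent E p)) := fun α β => by
    rw [← key β α]
    exact Finset.sum_congr rfl fun a _ => Finset.sum_congr rfl fun b _ => by rw [mul_comm]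
  have hw : toExt (w j k) = (1 / 2 : ℝ) • ∑ i : Fin 2,
      (ExteriorAlgebra.ι ℝ (v (i, j)) * ExteriorAlgebra.ι ℝ (v (i, k)) -
        ExteriorAlgebra.ι ℝ (v (i, k)) * ExteriorAlgebra.ι ℝ (v (i, j)) :
          Ext (Cotangent E p)) := by
    rw [toExt]
    congr 1
    simp only [h j k, Fin.sum_univ_two, add_smul, sub_smul, Finset.sum_add_distrib,
      Finset.sum_sub_distrib, key, key']
  rw [hw, stdForm, Finset.smul_sum]
  refine Finset.sum_congr rfl fun i _ => ?_
  rw [eq_neg_of_add_eq_zero_left (ExteriorAlgebra.ι_add_mul_swap (R := ℝ) (v (i, k)) (v (i, j)))]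
  module

theorem inner_eq_apply (α β : Cotangent E p) :
    (inner ℝ α β : ℝ) = α ((InnerProductSpace.toDual ℝ _).symm β) := by
  conv_rhs => rw [← (InnerProductSpace.toDual ℝ (TangentSpace 𝓘(ℝ, E) p)).apply_symm_apply α]
  rw [InnerProductSpace.toDual_apply_apply]
  rfl

/-- For `k` distinct from `j` and `q.2`, evaluate ω_jk on the vectors dual to `v q` and `v' (i, k)`.
In the coframe `v` the result is 0, as `v q` is orthogonal to W_j and W_k; in `v'` it is the inner
product in question. -/
theorem inner_eq_zero_of_isAdapted (hs : 2 ≤ s)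
    {w : Fin (s + 1) → Fin (s + 1) → TangentSpace 𝓘(ℝ, E) p [⋀^Fin 2]→L[ℝ] ℝ}
    {v v' : OrthonormalBasis (Fin 2 × Fin (s + 1)) ℝ (Cotangent E p)}
    (h : IsAdapted w v) (h' : IsAdapted w v') (i : Fin 2) (q : Fin 2 × Fin (s + 1))
    (j : Fin (s + 1)) (hq : q.2 ≠ j) : inner ℝ (v q) (v' (i, j)) = 0 := by
  obtain ⟨k, hkj, hkq⟩ := exists_ne_ne hs j q.2
  have hv := orthonormal_iff_ite.mp v.orthonormal
  have hv' := orthonormal_iff_ite.mp v'.orthonormal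
  have e := (h j k ((InnerProductSpace.toDual ℝ _).symm (v q))
    ((InnerProductSpace.toDual ℝ _).symm (v' (i, k)))).symm.trans (h' j k _ _)
  obtain ⟨q1, q2⟩ := q
  simp only [← inner_eq_apply, hv, hv', Prod.mk.injEq, hkj.symm, hkq, Ne.symm hq, and_false,
    if_false, zero_mul, mul_zero, sub_zero, Finset.sum_const_zero, and_true, mul_ite, mul_one,
    Finset.sum_ite_eq', Finset.mem_univ, if_true] at e
  rw [real_inner_comm]
  exact e.symm

end Manifold

end SKahler

end

theorem mainTheorem5 {E : Type*} [NormedAddCommGroup E] [NormedSpace ℝ E] [FiniteDimensional ℝ E]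
    {M : Type*} [TopologicalSpace M] [ChartedSpace E M] [IsManifold 𝓘(ℝ, E) ∞ M]
    [RiemannianBundle (fun p : M => TangentSpace 𝓘(ℝ, E) p)]
    [IsContMDiffRiemannianBundle 𝓘(ℝ, E) ∞ E (fun p : M => TangentSpace 𝓘(ℝ, E) p)]
    (s : ℕ) (hs : 2 ≤ s) (S : SKahler.Structure E M s) (p : M) (v : S.Coframe p) :
    (∀ v' : S.Coframe p, S.realFibre v' = S.realFibre v) ∧
    (∀ φ : Module.End ℂ (SKahler.ExtC (SKahler.Cotangent E p)),
      (∃ ψ ∈ S.realFibre v, φ = LinearMap.baseChange ℂ ψ) ↔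
        φ ∈ S.complexFibre v ∧ SKahler.PreservesModifiedForm v.1 φ) ∧
    Nonempty (S.realFibre v ≃ₗ⁅ℝ⁆ SKahler.su (s + 1) (s + 1)) := by
  -- Adaptedness allows the two-forms of the structure to be replaced by those built from the
  -- coframe, which is the setting of the algebraic results.
  have hv : S.realFibre v = SKahler.realAlgebra (SKahler.stdForm v.1) v.1 := by
    rw [SKahler.Structure.realFibre]
    congr 1
    funext j k
    exact SKahler.toExt_eq_stdForm v.2 j k
  refine ⟨fun v' => le_antisymm ?_ ?_, fun φ => ?_, ?_⟩
  · exact SKahler.realAlgebra_le_of_inner_eq_zero _ v.1 v'.1 fun i q j =>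
      SKahler.inner_eq_zero_of_isAdapted hs v.2 v'.2 i q j
  · exact SKahler.realAlgebra_le_of_inner_eq_zero _ v'.1 v.1 fun i q j =>
      SKahler.inner_eq_zero_of_isAdapted hs v'.2 v.2 i q j
  · rw [SKahler.Structure.complexFibre]
    exact SKahler.exists_mem_iff_preserves v.1
      (hv.trans_le (SKahler.realAlgebra_le_preserving v.1)) φ
  · rw [hv]
    exact SKahler.nonempty_realAlgebra_equiv_su hs v.1
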